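/- Let $n_R,n_T,M$ and $K_1,\dots,K_M$ be nonnegative integers with $\sum_{m=1}^M K_m=n_T$. For an $n_R\times n_T$ complex matrix $H$ and $N_0>0$ consider the channel $Y=HX+N$ with independent $X\sim\mathcal{CN}(0,I_{n_T})$ and $N\sim\mathcal{CN}(0,N_0I_{n_R})$. For an $n_T\times n_R$ matrix $H_r$ and a Hermitian $n_T\times n_T$ matrix $G_r$ put $$\tilde T(y|x)=\exp\bigl(2\,\mathrm{Re}(x^{\mathsf H}H_ry)-x^{\mathsf H}G_rx\bigr),\qquad \tilde T(y)=\mathbb E_X\bigl[\tilde T(y|X)\bigr],$$ $$I_{\mathrm{GMI}}(H_r,G_r)=-\mathbb E\bigl[\log\tilde T(Y)\bigr]+\mathbb E\bigl[\log\tilde T(Y|X)\bigr].$$ Let $I_{\mathrm{GMI}}(H,N_0)$ be the maximum of $I_{\mathrm{GMI}}(H_r,G_r)$ over all $H_r$ and all Hermitian $G_r$ that are block diagonal with consecutive diagonal blocks of sizes $K_1\times K_1,\dots,K_M\times K_M$ (parameters with $\tilde T(y)=\infty$ have $I_{\mathrm{GMI}}(H_r,G_r)=-\infty$ and play no role). For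 $\mathrm{snr}>0$ let $N_0=n_T/\mathrm{snr}$, let $H$ have i.i.d. $\mathcal{CN}(0,1)$ entries, and let $\mathbb E[I_{\mathrm{GMI}}(\mathrm{snr})]$ be the expectation of $I_{\mathrm{GMI}}(H,n_T/\mathrm{snr})$ over $H$. (If $n_T=0$, all rates are $0$.) Then, for every $\mathrm{snr}>0$, the maximum is attained for every $H$ and the expectation over $H$ exists and is finite, and the high-SNR slope $$S_\infty^{\mathrm{BD}}=\lim_{\mathrm{snr}\to\infty}\frac{\mathbb E[I_{\mathrm{GMI}}(\mathrm{snr})]}{\log(\mathrm{snr})}$$ exists and equals $$S_\infty^{\mathrm{BD}}=\begin{cases}n_T,& n_R\ge n_T,\\[2pt] \displaystyle\sum_{m:\,K_m>n_T-n_R}\bigl(K_m-(n_T-n_R)\bigr),& n_T>n_R.\end{cases}$$ -/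

import Mathlib

open MeasureTheory ProbabilityTheory Filter Topology Matrix
open scoped NNReal

noncomputable section

namespace ChannelShortening

/-- The law `CN(0, v)` on `ℂ` (circularly symmetric, mean zero, variance `v`): real and imaginary
parts are independent centred real Gaussians of variance `v / 2`. -/
def complexGaussian (v : ℝ≥0) : Measure ℂ :=
  ((gaussianReal 0 (v / 2)).prod (gaussianReal 0 (v / 2))).map
    Complex.measurableEquivRealProd.symm

/-- The law `CN(0, v I_n)` on `ℂⁿ`: independent coordinates, each `CN(0, v)`. -/
def complexGaussianVec (n : ℕ) (v : ℝ≥0) : Measure (Fin n → ℂ) :=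
  Measure.pi fun _ => complexGaussian v

/-- The law of an `nR × nT` matrix with i.i.d. `CN(0, 1)` entries. -/
def channelLaw (nR nT : ℕ) : Measure (Fin nR → Fin nT → ℂ) :=
  Measure.pi fun _ : Fin nR => Measure.pi fun _ : Fin nT => complexGaussian 1

/-- The mismatched receiver function `T̃(y | x) = exp (2 Re (xᴴ Hr y) - xᴴ Gr x)`. For Hermitian
`Gr` the number `xᴴ Gr x` is real. -/
def receiverFun {nR nT : ℕ} (Hr : Matrix (Fin nT) (Fin nR) ℂ) (Gr : Matrix (Fin nT) (Fin nT) ℂ)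
    (y : Fin nR → ℂ) (x : Fin nT → ℂ) : ℝ :=
  Real.exp (2 * (star x ⬝ᵥ (Hr *ᵥ y)).re - (star x ⬝ᵥ (Gr *ᵥ x)).re)

/-- `T̃(y) = ∫ T̃(y | x) p_X(x) dx`, where `X ~ CN(0, I)`. -/
def receiverMarginal {nR nT : ℕ} (Hr : Matrix (Fin nT) (Fin nR) ℂ)
    (Gr : Matrix (Fin nT) (Fin nT) ℂ) (y : Fin nR → ℂ) : ℝ :=
  ∫ x, receiverFun Hr Gr y x ∂(complexGaussianVec nT 1)

/-- The generalized mutual information `- E[log T̃(Y)] + E[log T̃(Y | X)]` (in nats) over the channel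
`Y = H X + N` with independent `X ~ CN(0, I)` and `N ~ CN(0, N0 I)`. -/
def gmi {nR nT : ℕ} (H : Matrix (Fin nR) (Fin nT) ℂ) (N0 : ℝ≥0)
    (Hr : Matrix (Fin nT) (Fin nR) ℂ) (Gr : Matrix (Fin nT) (Fin nT) ℂ) : ℝ :=
  -(∫ z, Real.log (receiverMarginal Hr Gr (H *ᵥ z.1 + z.2))
      ∂((complexGaussianVec nT 1).prod (complexGaussianVec nR N0)))
  + ∫ z, Real.log (receiverFun Hr Gr (H *ᵥ z.1 + z.2) z.1)
      ∂((complexGaussianVec nT 1).prod (complexGaussianVec nR N0))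

/-- The 0-based position `T_m = K_1 + ... + K_{m-1}` at which the `m`-th block starts. -/
def blockStart {M : ℕ} (K : Fin M → ℕ) (m : Fin M) : ℕ := ∑ l ∈ Finset.Iio m, K l

/-- `G` is block diagonal with consecutive diagonal blocks of sizes `K_1, ..., K_M`: every nonzero
entry has its row and its column index in one and the same block. -/
def IsBlockDiag {M nT : ℕ} (K : Fin M → ℕ) (G : Matrix (Fin nT) (Fin nT) ℂ) : Prop :=
  ∀ i j : Fin nT, G i j ≠ 0 → ∃ m : Fin M,
    (blockStart K m ≤ i ∧ (i : ℕ) < blockStart K m + K m) ∧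
    (blockStart K m ≤ j ∧ (j : ℕ) < blockStart K m + K m)

/-- The values of the generalized mutual information over all receiver parameters: `Hr` arbitrary,
`Gr` Hermitian and block diagonal. The integrability clause says `T̃(y) < ∞`; parameters that violate
it have `T̃(y) = ∞`, hence mutual information `-∞`, and take no part in the maximization (the integral
in `receiverMarginal` would be meaningless for them). -/
def blockGmiValues {nR nT M : ℕ} (K : Fin M → ℕ) (H : Matrix (Fin nR) (Fin nT) ℂ) (N0 : ℝ≥0) :
    Set ℝ :=
  {r | ∃ (Hr : Matrix (Fin nT) (Fin nR) ℂ) (Gr : Matrix (Fin nT) (Fin nT) ℂ),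
    Gr.IsHermitian ∧ IsBlockDiag K Gr ∧
    (∀ y, Integrable (receiverFun Hr Gr y) (complexGaussianVec nT 1)) ∧
    r = gmi H N0 Hr Gr}

/-- The optimized rate `I_GMI` of the block diagonal receiver for the channel matrix `H`. -/
def blockGmi {nR nT M : ℕ} (K : Fin M → ℕ) (H : Matrix (Fin nR) (Fin nT) ℂ) (N0 : ℝ≥0) : ℝ :=
  sSup (blockGmiValues K H N0)

/-- The noise density at signal-to-noise ratio `snr`, i.e. `1 / N0 = snr / nT`. -/
def noiseDensity (nT : ℕ) (snr : ℝ) : ℝ≥0 := ((nT : ℝ) / snr).toNNReal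

/-- The ergodic rate `E[I_GMI(snr)]` over the i.i.d. complex Gaussian channel. -/
def ergodicBlockRate (nR nT : ℕ) {M : ℕ} (K : Fin M → ℕ) (snr : ℝ) : ℝ :=
  ∫ H, blockGmi K (Matrix.of H) (noiseDensity nT snr) ∂(channelLaw nR nT)

end ChannelShortening

end

noncomputable section

set_option linter.unusedSectionVars false

namespace ChannelShortening

open scoped ComplexOrder

/-! ### Gaussian integrals in one real and one complex variable. -/

section ComplexGaussian

/-! Put F = 1 + G, R = HHᴴ + N0·1, ρ = 1/N0 and A = 1 + ρHᴴH. In an eigenbasis of G the Gaussian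
integral for T̃(y) factors, by unitary invariance of CN(0, I). It is finite exactly when F is
positive definite, and then its logarithm is explicit (`log_receiverMarginal`). Second moments turn
the rate into log det F plus traces (`gmi_eq`).

Completing the square in Hr (`completed_square`) and using A⁻¹ = 1 - HᴴR⁻¹H
(`inv_one_add_smul_gram`) leaves log det F + nT - tr(F A⁻¹) minus a nonnegative term that vanishes
at Hr = F Hᴴ R⁻¹. Since F is block diagonal, only the block diagonal part D of A⁻¹ enters the trace.
By log λ ≤ λ - 1 on eigenvalues the maximum is -log det D, at F = D⁻¹ (`log_det_sub_trace_mul_le`).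
Complementary minors of the inverse (`det_toSquareBlockProp_inv_mul_det`) rewrite this as the sum
over m of log det(1 + ρHᴴH) - log det(1 + ρHₘᴴHₘ), where Hₘ is H with the columns of block m deleted
(`isGreatest_blockGmiValues`).

Divided by log snr, each log-determinant tends to the rank of its matrix, one unit per nonzero
eigenvalue. Almost surely every column submatrix has full rank (`ae_rank_submatrix_eq`), and
dominated convergence passes to expectations. The slope is thus the sum over m of min(nR, nT) -
min(nR, nT - Kₘ), which is evaluated in the two cases. -/

instance isProbabilityMeasure_complexGaussian (v : ℝ≥0) :
    IsProbabilityMeasure (complexGaussian v) :=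
  Measure.isProbabilityMeasure_map (MeasurableEquiv.measurable _).aemeasurable

instance isProbabilityMeasure_complexGaussianVec (n : ℕ) (v : ℝ≥0) :
    IsProbabilityMeasure (complexGaussianVec n v) := by
  unfold complexGaussianVec; infer_instance

instance isProbabilityMeasure_channelLaw (nR nT : ℕ) :
    IsProbabilityMeasure (channelLaw nR nT) := by
  unfold channelLaw; infer_instance

theorem measurePreserving_equivRealProd_symm (v : ℝ≥0) :
    MeasurePreserving Complex.measurableEquivRealProd.symm
      ((gaussianReal 0 (v / 2)).prod (gaussianReal 0 (v / 2))) (complexGaussian v) :=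
  ⟨MeasurableEquiv.measurable _, rfl⟩

theorem integral_complexGaussian {E : Type*} [NormedAddCommGroup E] [NormedSpace ℝ E] (v : ℝ≥0)
    (f : ℂ → E) :
    ∫ z, f z ∂complexGaussian v =
      ∫ p : ℝ × ℝ, f ⟨p.1, p.2⟩ ∂(gaussianReal 0 (v / 2)).prod (gaussianReal 0 (v / 2)) :=
  ((measurePreserving_equivRealProd_symm v).integral_comp'
    (f := Complex.measurableEquivRealProd.symm) f).symm

theorem integrable_complexGaussian_iff {E : Type*} [NormedAddCommGroup E] (v : ℝ≥0) {f : ℂ → E} :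
    Integrable f (complexGaussian v) ↔
      Integrable (fun p : ℝ × ℝ => f ⟨p.1, p.2⟩)
        ((gaussianReal 0 (v / 2)).prod (gaussianReal 0 (v / 2))) :=
  ((measurePreserving_equivRealProd_symm v).integrable_comp_emb
    (MeasurableEquiv.measurableEmbedding _)).symm

theorem gaussianPDFReal_half (x : ℝ) :
    gaussianPDFReal 0 (1 / 2) x = (√Real.pi)⁻¹ * Real.exp (-x ^ 2) := by
  rw [gaussianPDFReal]
  congr 2
  · congr 1; push_cast; ring
  · push_cast; ring_nf

theorem integrable_gaussianReal_half_iff {f : ℝ → ℝ} :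
    Integrable f (gaussianReal 0 (1 / 2)) ↔ Integrable fun x => Real.exp (-x ^ 2) * f x := by
  rw [gaussianReal_of_var_ne_zero 0 (by norm_num), integrable_withDensity_iff_integrable_smul'
    (measurable_gaussianPDF _ _) (by simp [gaussianPDF_lt_top])]
  simp_rw [toReal_gaussianPDF, gaussianPDFReal_half, smul_eq_mul, mul_assoc]
  exact integrable_const_mul_iff (by simp [Real.pi_pos, Real.sqrt_ne_zero'.mpr]) _

/-- The weight exp(-x²) is the N(0, 1/2) density up to a constant, so it shifts the quadratic
coefficient from g to 1 + g. This is the origin of 1 + G everywhere below. -/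
theorem exp_complete_square {g : ℝ} (hg : 0 < 1 + g) (a x : ℝ) :
    Real.exp (-x ^ 2) * Real.exp (2 * a * x - g * x ^ 2) =
      Real.exp (a ^ 2 / (1 + g)) * Real.exp (-(1 + g) * (x - a / (1 + g)) ^ 2) := by
  rw [← Real.exp_add, ← Real.exp_add]
  congr 1
  field_simp
  ring

theorem integrable_exp_quadratic_gaussianReal {g : ℝ} (hg : 0 < 1 + g) (a : ℝ) :
    Integrable (fun x => Real.exp (2 * a * x - g * x ^ 2)) (gaussianReal 0 (1 / 2)) := by
  rw [integrable_gaussianReal_half_iff]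
  simp_rw [exp_complete_square hg]
  exact ((integrable_exp_neg_mul_sq hg).comp_sub_right (a / (1 + g))).const_mul _

theorem integral_exp_quadratic_gaussianReal {g : ℝ} (hg : 0 < 1 + g) (a : ℝ) :
    ∫ x, Real.exp (2 * a * x - g * x ^ 2) ∂gaussianReal 0 (1 / 2) =
      (√(1 + g))⁻¹ * Real.exp (a ^ 2 / (1 + g)) := by
  rw [integral_gaussianReal_eq_integral_smul (by norm_num)]
  have h (x : ℝ) := mul_assoc (√Real.pi)⁻¹ (Real.exp (-x ^ 2)) (Real.exp (2 * a * x - g * x ^ 2))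
  simp_rw [gaussianPDFReal_half, smul_eq_mul, h, exp_complete_square hg]
  rw [integral_const_mul, integral_const_mul,
    integral_sub_right_eq_self (fun x => Real.exp (-(1 + g) * x ^ 2)) (a / (1 + g)),
    integral_gaussian, Real.sqrt_div Real.pi_pos.le]
  have := (Real.sqrt_pos.mpr Real.pi_pos).ne'
  field_simp

theorem one_add_pos_of_integrable_gaussianReal {g : ℝ}
    (h : Integrable (fun x => Real.exp (-g * x ^ 2)) (gaussianReal 0 (1 / 2))) : 0 < 1 + g := by
  rw [integrable_gaussianReal_half_iff] at h
  refine integrable_exp_neg_mul_sq_iff.mp (h.congr (ae_of_all _ fun x => ?_))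
  simp only [← Real.exp_add]
  congr 1; ring

/-- The exponent of the scalar receiver function, split into real and imaginary parts. -/
theorem exp_scalar_split (c : ℂ) (g a b : ℝ) :
    Real.exp (2 * (star (⟨a, b⟩ : ℂ) * c).re - g * ‖(⟨a, b⟩ : ℂ)‖ ^ 2) =
      Real.exp (2 * c.re * a - g * a ^ 2) * Real.exp (2 * c.im * b - g * b ^ 2) := by
  rw [← Real.exp_add, ← Complex.normSq_eq_norm_sq, Complex.normSq_mk]
  congr 1
  simp
  ring

theorem integrable_exp_quadratic_complexGaussian {g : ℝ} (hg : 0 < 1 + g) (c : ℂ) :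
    Integrable (fun z : ℂ => Real.exp (2 * (star z * c).re - g * ‖z‖ ^ 2)) (complexGaussian 1) := by
  rw [integrable_complexGaussian_iff]
  simp_rw [exp_scalar_split]
  exact (integrable_exp_quadratic_gaussianReal hg _).mul_prod
    (integrable_exp_quadratic_gaussianReal hg _)

theorem integral_exp_quadratic_complexGaussian {g : ℝ} (hg : 0 < 1 + g) (c : ℂ) :
    ∫ z : ℂ, Real.exp (2 * (star z * c).re - g * ‖z‖ ^ 2) ∂complexGaussian 1 =
      (1 + g)⁻¹ * Real.exp (‖c‖ ^ 2 / (1 + g)) := by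
  rw [integral_complexGaussian]
  simp_rw [exp_scalar_split]
  rw [integral_prod_mul (fun a => Real.exp (2 * c.re * a - g * a ^ 2))
      (fun b => Real.exp (2 * c.im * b - g * b ^ 2)),
    integral_exp_quadratic_gaussianReal hg, integral_exp_quadratic_gaussianReal hg,
    mul_mul_mul_comm, ← mul_inv, Real.mul_self_sqrt hg.le, ← Real.exp_add, ← add_div,
    ← Complex.normSq_eq_norm_sq, Complex.normSq_apply, sq, sq]

/-- By Fubini some section with frozen real part is integrable. On it the integrand is a positive
constant times the real one. -/
theorem one_add_pos_of_integrable_complexGaussian {g : ℝ}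
    (h : Integrable (fun z : ℂ => Real.exp (-g * ‖z‖ ^ 2)) (complexGaussian 1)) : 0 < 1 + g := by
  rw [integrable_complexGaussian_iff] at h
  obtain ⟨a, ha⟩ := h.prod_right_ae.exists
  refine one_add_pos_of_integrable_gaussianReal
    ((integrable_const_mul_iff (c := Real.exp (-g * a ^ 2)) (by simp) _).mp
      (ha.congr (ae_of_all _ fun b => ?_)))
  simp only [← Real.exp_add, ← Complex.normSq_eq_norm_sq, Complex.normSq_mk]
  congr 1; ring

theorem charFun_complexGaussian (t : ℂ) :
    charFun (complexGaussian 1) t = Complex.exp (-(‖t‖ ^ 2 / 4 : ℝ)) := by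
  have h : ∀ a b : ℝ, Complex.exp ((inner ℝ (⟨a, b⟩ : ℂ) t : ℝ) * Complex.I) =
      Complex.exp (t.re * a * Complex.I) * Complex.exp (t.im * b * Complex.I) := by
    intro a b
    rw [← Complex.exp_add, Complex.inner]
    congr 1
    simp
    ring
  rw [charFun_apply, integral_complexGaussian]
  simp_rw [h]
  rw [integral_prod_mul (fun a : ℝ => Complex.exp (t.re * a * Complex.I))
      (fun b : ℝ => Complex.exp (t.im * b * Complex.I)), ← charFun_apply_real, ← charFun_apply_real,
    charFun_gaussianReal, charFun_gaussianReal, ← Complex.exp_add, ← Complex.normSq_eq_norm_sq,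
    Complex.normSq_apply]
  congr 1
  push_cast
  ring

end ComplexGaussian

/-! ### Unitary invariance of the standard complex Gaussian vector. -/

section UnitaryInvariance

variable {n : ℕ}

theorem charFun_complexGaussianVec (t : EuclideanSpace ℂ (Fin n)) :
    charFun ((complexGaussianVec n 1).map (WithLp.toLp 2)) t =
      Complex.exp (-(‖t‖ ^ 2 / 4 : ℝ)) := by
  rw [complexGaussianVec, charFun_pi, EuclideanSpace.norm_sq_eq]
  simp_rw [charFun_complexGaussian]
  rw [← Complex.exp_sum]
  congr 1
  push_cast
  rw [Finset.sum_neg_distrib, Finset.sum_div]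

theorem re_inner_mulVec (U : Matrix (Fin n) (Fin n) ℂ) (x t : Fin n → ℂ) :
    inner ℝ (WithLp.toLp 2 (U *ᵥ x) : EuclideanSpace ℂ (Fin n)) (WithLp.toLp 2 t) =
      inner ℝ (WithLp.toLp 2 x : EuclideanSpace ℂ (Fin n)) (WithLp.toLp 2 (Uᴴ *ᵥ t)) := by
  have key : ∀ a b : Fin n → ℂ,
      inner ℝ (WithLp.toLp 2 a : EuclideanSpace ℂ (Fin n)) (WithLp.toLp 2 b) =
        (star a ⬝ᵥ b).re := by
    intro a b
    simp only [PiLp.inner_apply, dotProduct, Complex.re_sum, Pi.star_apply]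
    refine Finset.sum_congr rfl fun i _ => ?_
    simp [Complex.inner]
    ring
  rw [key, key, star_mulVec, ← dotProduct_mulVec]

theorem norm_sq_toLp (t : Fin n → ℂ) :
    ‖(WithLp.toLp 2 t : EuclideanSpace ℂ (Fin n))‖ ^ 2 = (star t ⬝ᵥ t).re := by
  rw [EuclideanSpace.norm_sq_eq]
  simp only [dotProduct, Complex.re_sum, Pi.star_apply]
  refine Finset.sum_congr rfl fun i _ => ?_
  rw [← Complex.normSq_eq_norm_sq, Complex.normSq_apply]
  simp

/-- The characteristic function at t depends only on ‖t‖; moving U across the inner product replaces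
t by Uᴴt, which has the same norm. -/
theorem measurePreserving_mulVec_complexGaussianVec {U : Matrix (Fin n) (Fin n) ℂ}
    (hU : U * Uᴴ = 1) :
    MeasurePreserving (fun x => U *ᵥ x) (complexGaussianVec n 1) (complexGaussianVec n 1) := by
  have hm : Measurable fun x : Fin n → ℂ => U *ᵥ x :=
    (Continuous.matrix_mulVec continuous_const continuous_id).measurable
  refine ⟨hm, ?_⟩
  refine (MeasurableEquiv.toLp 2 (Fin n → ℂ)).map_measurableEquiv_injective ?_
  rw [MeasurableEquiv.coe_toLp]
  have : IsProbabilityMeasure ((complexGaussianVec n 1).map fun x => U *ᵥ x) :=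
    Measure.isProbabilityMeasure_map hm.aemeasurable
  refine Measure.ext_of_charFun (funext fun t => ?_)
  rw [charFun_complexGaussianVec, charFun_apply, ← MeasurableEquiv.coe_toLp, integral_map_equiv,
    integral_map hm.aemeasurable (by fun_prop)]
  have h := charFun_complexGaussianVec (WithLp.toLp 2 (Uᴴ *ᵥ t.ofLp) : EuclideanSpace ℂ (Fin n))
  rw [charFun_apply, ← MeasurableEquiv.coe_toLp, integral_map_equiv] at h
  simp only [MeasurableEquiv.coe_toLp] at h ⊢
  have h2 : ∀ x : Fin n → ℂ,
      inner ℝ (WithLp.toLp 2 (U *ᵥ x) : EuclideanSpace ℂ (Fin n)) t =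
      inner ℝ (WithLp.toLp 2 x : EuclideanSpace ℂ (Fin n)) (WithLp.toLp 2 (Uᴴ *ᵥ t.ofLp)) :=
    fun x => re_inner_mulVec U x t.ofLp
  simp_rw [h2]
  rw [h, norm_sq_toLp, star_mulVec, conjTranspose_conjTranspose, dotProduct_mulVec,
    vecMul_vecMul, hU, vecMul_one, ← norm_sq_toLp]

end UnitaryInvariance

/-! ### Finiteness and closed form of T̃(y). -/

section Marginal

/-- If a product of positive functions of the separate coordinates is integrable, then so is each
factor. -/
theorem integrable_of_integrable_pi_prod {E : Type*} {mE : MeasurableSpace E} {n : ℕ}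
    {μ : Fin n → Measure E} [∀ i, IsProbabilityMeasure (μ i)] {f : Fin n → E → ℝ}
    (hf : ∀ i x, 0 < f i x) (h : Integrable (fun x : Fin n → E => ∏ i, f i (x i)) (Measure.pi μ))
    (i : Fin n) : Integrable (f i) (μ i) := by
  obtain _ | n := n
  · exact i.elim0
  have hmp := (measurePreserving_piFinSuccAbove μ i).symm
  rw [← hmp.integrable_comp_emb (MeasurableEquiv.measurableEmbedding _)] at h
  -- Once the other coordinates are frozen at a good point, their factors form a positive constant
  -- that can be cancelled.
  obtain ⟨y, hy⟩ := h.prod_left_ae.exists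
  have hc : 0 < ∏ j, f (i.succAbove j) (y j) := Finset.prod_pos fun j _ => hf _ _
  refine (integrable_mul_const_iff (c := ∏ j, f (i.succAbove j) (y j))
    (isUnit_iff_ne_zero.mpr hc.ne') _).mp (hy.congr (ae_of_all _ fun x => ?_))
  simp [MeasurableEquiv.piFinSuccAbove_symm_apply, Fin.insertNthEquiv,
    Fin.prod_univ_succAbove _ i]

variable {nR nT : ℕ} {G : Matrix (Fin nT) (Fin nT) ℂ}

theorem eigenvectorUnitary_mul_conjTranspose (hG : G.IsHermitian) :
    (hG.eigenvectorUnitary : Matrix (Fin nT) (Fin nT) ℂ) *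
      (hG.eigenvectorUnitary : Matrix (Fin nT) (Fin nT) ℂ)ᴴ = 1 := by
  rw [← star_eq_conjTranspose]
  exact Unitary.coe_mul_star_self _

theorem eigenvectorUnitary_conjTranspose_mul (hG : G.IsHermitian) :
    (hG.eigenvectorUnitary : Matrix (Fin nT) (Fin nT) ℂ)ᴴ *
      (hG.eigenvectorUnitary : Matrix (Fin nT) (Fin nT) ℂ) = 1 := by
  rw [← star_eq_conjTranspose]
  exact Unitary.coe_star_mul_self _

theorem eq_eigenvectorUnitary_mul_diagonal (hG : G.IsHermitian) :
    G = (hG.eigenvectorUnitary : Matrix (Fin nT) (Fin nT) ℂ) *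
      diagonal (fun i => (hG.eigenvalues i : ℂ)) *
      (hG.eigenvectorUnitary : Matrix (Fin nT) (Fin nT) ℂ)ᴴ := by
  conv_lhs => rw [hG.spectral_theorem]
  rfl

theorem one_add_eq_eigenvectorUnitary_mul_diagonal (hG : G.IsHermitian) :
    1 + G = (hG.eigenvectorUnitary : Matrix (Fin nT) (Fin nT) ℂ) *
      diagonal (fun i => ((1 + hG.eigenvalues i : ℝ) : ℂ)) *
      (hG.eigenvectorUnitary : Matrix (Fin nT) (Fin nT) ℂ)ᴴ := by
  have h : diagonal (fun i => ((1 + hG.eigenvalues i : ℝ) : ℂ)) =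
      1 + diagonal fun i => (hG.eigenvalues i : ℂ) := by
    rw [← diagonal_one, diagonal_add]
    push_cast
    rfl
  rw [h, mul_add, add_mul, mul_one, eigenvectorUnitary_mul_conjTranspose,
    ← eq_eigenvectorUnitary_mul_diagonal hG]

theorem posDef_one_add_iff (hG : G.IsHermitian) :
    (1 + G).PosDef ↔ ∀ i, 0 < 1 + hG.eigenvalues i := by
  have hU : IsUnit (hG.eigenvectorUnitary : Matrix (Fin nT) (Fin nT) ℂ) :=
    IsUnit.of_mul_eq_one _ (eigenvectorUnitary_mul_conjTranspose hG)
  rw [one_add_eq_eigenvectorUnitary_mul_diagonal hG, ← star_eq_conjTranspose,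
    Matrix.IsUnit.posDef_star_right_conjugate_iff hU, posDef_diagonal_iff]
  simp only [Complex.zero_lt_real]

theorem re_star_dotProduct_unitary_diagonal (U : Matrix (Fin nT) (Fin nT) ℂ) (d : Fin nT → ℝ)
    (b : Fin nT → ℂ) :
    (star b ⬝ᵥ ((U * diagonal (fun i => (d i : ℂ)) * Uᴴ) *ᵥ b)).re =
      ∑ i, d i * ‖(Uᴴ *ᵥ b) i‖ ^ 2 := by
  have h : star b ⬝ᵥ ((U * diagonal (fun i => (d i : ℂ)) * Uᴴ) *ᵥ b) =
      star (Uᴴ *ᵥ b) ⬝ᵥ (diagonal (fun i => (d i : ℂ)) *ᵥ (Uᴴ *ᵥ b)) := by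
    rw [star_mulVec, conjTranspose_conjTranspose, ← dotProduct_mulVec, mulVec_mulVec, mulVec_mulVec]
  rw [h, dotProduct, Complex.re_sum]
  refine Finset.sum_congr rfl fun i _ => ?_
  rw [mulVec_diagonal, ← Complex.normSq_eq_norm_sq, Complex.normSq_apply]
  simp
  ring

theorem receiverFun_eigenvectorUnitary_mulVec (hG : G.IsHermitian)
    (Hr : Matrix (Fin nT) (Fin nR) ℂ) (y : Fin nR → ℂ) (z : Fin nT → ℂ) :
    receiverFun Hr G y ((hG.eigenvectorUnitary : Matrix (Fin nT) (Fin nT) ℂ) *ᵥ z) =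
      ∏ i, Real.exp (2 * (star (z i) *
        ((hG.eigenvectorUnitary : Matrix (Fin nT) (Fin nT) ℂ)ᴴ *ᵥ (Hr *ᵥ y)) i).re -
        hG.eigenvalues i * ‖z i‖ ^ 2) := by
  have h1 := re_star_dotProduct_unitary_diagonal
    (hG.eigenvectorUnitary : Matrix (Fin nT) (Fin nT) ℂ) hG.eigenvalues
    ((hG.eigenvectorUnitary : Matrix (Fin nT) (Fin nT) ℂ) *ᵥ z)
  rw [← eq_eigenvectorUnitary_mul_diagonal hG,
    mulVec_mulVec z (hG.eigenvectorUnitary : Matrix (Fin nT) (Fin nT) ℂ)ᴴ,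
    eigenvectorUnitary_conjTranspose_mul, one_mulVec] at h1
  rw [receiverFun, h1, ← Real.exp_sum, star_mulVec, ← dotProduct_mulVec, Finset.sum_sub_distrib,
    dotProduct, Complex.re_sum, Finset.mul_sum]
  rfl

theorem continuous_receiverFun (Hr : Matrix (Fin nT) (Fin nR) ℂ) (y : Fin nR → ℂ) :
    Continuous (receiverFun Hr G y) := by
  unfold receiverFun
  simp only [dotProduct, mulVec]
  fun_prop

/-- At y = 0 the linear term disappears, and in the eigenbasis the integrand is a product of
exp(-λᵢ|zᵢ|²); each factor forces 1 + λᵢ > 0. -/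
theorem posDef_of_integrable_receiverFun (hG : G.IsHermitian) (Hr : Matrix (Fin nT) (Fin nR) ℂ)
    (h : Integrable (receiverFun Hr G 0) (complexGaussianVec nT 1)) : (1 + G).PosDef := by
  rw [posDef_one_add_iff hG]
  intro i
  have hmp := measurePreserving_mulVec_complexGaussianVec (eigenvectorUnitary_mul_conjTranspose hG)
  have h1 := hmp.integrable_comp_of_integrable h
  refine one_add_pos_of_integrable_complexGaussian
    (integrable_of_integrable_pi_prod (μ := fun _ => complexGaussian 1)
      (f := fun i (z : ℂ) => Real.exp (-hG.eigenvalues i * ‖z‖ ^ 2))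
      (fun _ _ => Real.exp_pos _) (h1.congr (ae_of_all _ fun z => ?_)) i)
  simp only [Function.comp, receiverFun_eigenvectorUnitary_mulVec]
  simp

theorem integrable_receiverFun (hG : G.IsHermitian) (hF : (1 + G).PosDef)
    (Hr : Matrix (Fin nT) (Fin nR) ℂ) (y : Fin nR → ℂ) :
    Integrable (receiverFun Hr G y) (complexGaussianVec nT 1) := by
  rw [posDef_one_add_iff hG] at hF
  have hmp := measurePreserving_mulVec_complexGaussianVec (eigenvectorUnitary_mul_conjTranspose hG)
  rw [← hmp.integrable_comp (continuous_receiverFun Hr y).aestronglyMeasurable]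
  simp only [Function.comp_def, receiverFun_eigenvectorUnitary_mulVec]
  exact Integrable.fintype_prod (f := fun i (z : ℂ) => Real.exp (2 * (star z *
      ((hG.eigenvectorUnitary : Matrix (Fin nT) (Fin nT) ℂ)ᴴ *ᵥ (Hr *ᵥ y)) i).re -
      hG.eigenvalues i * ‖z‖ ^ 2))
    fun i => integrable_exp_quadratic_complexGaussian (hF i) _

/-- In the eigenbasis each coordinate contributes (1 + λᵢ)⁻¹ exp(|cᵢ|²/(1 + λᵢ)), with cᵢ a
coordinate of Hr y. The prefactors assemble to det(1 + G)⁻¹ and the exponents to the quadratic form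
of (1 + G)⁻¹. -/
theorem log_receiverMarginal (hG : G.IsHermitian) (hF : (1 + G).PosDef)
    (Hr : Matrix (Fin nT) (Fin nR) ℂ) (y : Fin nR → ℂ) :
    Real.log (receiverMarginal Hr G y) =
      -Real.log (1 + G).det.re + (star (Hr *ᵥ y) ⬝ᵥ ((1 + G)⁻¹ *ᵥ (Hr *ᵥ y))).re := by
  have hF' := (posDef_one_add_iff hG).mp hF
  set U := (hG.eigenvectorUnitary : Matrix (Fin nT) (Fin nT) ℂ) with hU
  have hmp := measurePreserving_mulVec_complexGaussianVec (eigenvectorUnitary_mul_conjTranspose hG)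
  have hinv : (1 + G)⁻¹ =
      U * diagonal (fun i => (((1 + hG.eigenvalues i)⁻¹ : ℝ) : ℂ)) * Uᴴ := by
    refine inv_eq_left_inv ?_
    rw [one_add_eq_eigenvectorUnitary_mul_diagonal hG, ← hU]
    calc _ = U * (diagonal (fun i => (((1 + hG.eigenvalues i)⁻¹ : ℝ) : ℂ)) * (Uᴴ * U) *
          diagonal (fun i => ((1 + hG.eigenvalues i : ℝ) : ℂ))) * Uᴴ := by
          simp only [Matrix.mul_assoc]
      _ = 1 := by
          rw [eigenvectorUnitary_conjTranspose_mul, mul_one, diagonal_mul_diagonal]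
          have : (fun i => (((1 + hG.eigenvalues i)⁻¹ : ℝ) : ℂ) *
              ((1 + hG.eigenvalues i : ℝ) : ℂ)) = fun _ => 1 := by
            funext i
            rw [← Complex.ofReal_mul, inv_mul_cancel₀ (hF' i).ne', Complex.ofReal_one]
          rw [this, diagonal_one, mul_one, eigenvectorUnitary_mul_conjTranspose]
  have hdet : (1 + G).det = ((∏ i, (1 + hG.eigenvalues i) : ℝ) : ℂ) := by
    rw [one_add_eq_eigenvectorUnitary_mul_diagonal hG, det_mul_right_comm,
      eigenvectorUnitary_mul_conjTranspose, one_mul, det_diagonal, Complex.ofReal_prod]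
  have hmarg : receiverMarginal Hr G y = ∏ i, ((1 + hG.eigenvalues i)⁻¹ *
      Real.exp (‖(Uᴴ *ᵥ (Hr *ᵥ y)) i‖ ^ 2 / (1 + hG.eigenvalues i))) := by
    rw [receiverMarginal, ← hmp.map_eq, integral_map hmp.measurable.aemeasurable
      (continuous_receiverFun Hr y).aestronglyMeasurable]
    simp only [receiverFun_eigenvectorUnitary_mulVec]
    rw [complexGaussianVec, integral_fintype_prod_eq_prod
      (f := fun i (z : ℂ) => Real.exp (2 * (star z *
        ((hG.eigenvectorUnitary : Matrix (Fin nT) (Fin nT) ℂ)ᴴ *ᵥ (Hr *ᵥ y)) i).re -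
        hG.eigenvalues i * ‖z‖ ^ 2))]
    exact Finset.prod_congr rfl fun i _ => integral_exp_quadratic_complexGaussian (hF' i) _
  rw [hmarg, hinv, re_star_dotProduct_unitary_diagonal, hdet, Complex.ofReal_re,
    Real.log_prod (fun i _ => mul_ne_zero (inv_ne_zero (hF' i).ne') (Real.exp_pos _).ne'),
    Real.log_prod fun i _ => (hF' i).ne', ← Finset.sum_neg_distrib, ← Finset.sum_add_distrib]
  refine Finset.sum_congr rfl fun i _ => ?_
  rw [Real.log_mul (inv_ne_zero (hF' i).ne') (Real.exp_pos _).ne', Real.log_inv, Real.log_exp,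
    div_eq_inv_mul]

end Marginal

/-! ### Second moments of complex Gaussian vectors and expected sesquilinear forms. -/

section Moments

theorem integrable_sq_gaussianReal (v : ℝ≥0) :
    Integrable (fun x : ℝ => x ^ 2) (gaussianReal 0 v) :=
  (memLp_id_gaussianReal (μ := 0) (v := v) 2).integrable_sq

theorem integral_sq_gaussianReal (v : ℝ≥0) : ∫ x : ℝ, x ^ 2 ∂gaussianReal 0 v = v := by
  have h := variance_eq_integral (μ := gaussianReal 0 v) (X := id) measurable_id.aemeasurable
  rw [variance_id_gaussianReal] at h
  simpa [integral_id_gaussianReal] using h.symm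

theorem norm_mk_sq (a b : ℝ) : ‖(⟨a, b⟩ : ℂ)‖ ^ 2 = a ^ 2 + b ^ 2 := by
  rw [← Complex.normSq_eq_norm_sq, Complex.normSq_mk, sq, sq]

theorem integrable_norm_sq_complexGaussian (v : ℝ≥0) :
    Integrable (fun z : ℂ => ‖z‖ ^ 2) (complexGaussian v) := by
  rw [integrable_complexGaussian_iff]
  simp_rw [norm_mk_sq]
  exact ((integrable_sq_gaussianReal _).comp_fst _).add ((integrable_sq_gaussianReal _).comp_snd _)

theorem integral_norm_sq_complexGaussian (v : ℝ≥0) :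
    ∫ z : ℂ, ‖z‖ ^ 2 ∂complexGaussian v = v := by
  rw [integral_complexGaussian]
  simp_rw [norm_mk_sq]
  rw [integral_add ((integrable_sq_gaussianReal _).comp_fst _)
      ((integrable_sq_gaussianReal _).comp_snd _),
    integral_fun_fst (fun x : ℝ => x ^ 2), integral_fun_snd (fun x : ℝ => x ^ 2),
    integral_sq_gaussianReal]
  simp

theorem memLp_id_complexGaussian (v : ℝ≥0) : MemLp (fun z : ℂ => z) 2 (complexGaussian v) :=
  (memLp_two_iff_integrable_sq_norm (by fun_prop)).mpr (integrable_norm_sq_complexGaussian v)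

theorem integral_id_complexGaussian (v : ℝ≥0) : ∫ z : ℂ, z ∂complexGaussian v = 0 := by
  have hi : Integrable (fun z : ℂ => z) (complexGaussian v) :=
    (memLp_id_complexGaussian v).integrable (by norm_num)
  apply Complex.ext
  · rw [← RCLike.re_eq_complex_re, ← integral_re hi, integral_complexGaussian]
    simp only [RCLike.re_eq_complex_re]
    rw [integral_fun_fst (fun x : ℝ => x), integral_id_gaussianReal]
    simp
  · rw [← RCLike.im_eq_complex_im, ← integral_im hi, integral_complexGaussian]
    simp only [RCLike.im_eq_complex_im]
    rw [integral_fun_snd (fun x : ℝ => x), integral_id_gaussianReal]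
    simp

theorem memLp_eval_complexGaussianVec {n : ℕ} (v : ℝ≥0) (i : Fin n) :
    MemLp (fun x : Fin n → ℂ => x i) 2 (complexGaussianVec n v) :=
  (memLp_id_complexGaussian v).comp_measurePreserving
    (measurePreserving_eval (fun _ : Fin n => complexGaussian v) i)

theorem integral_eval_complexGaussianVec {n : ℕ} (v : ℝ≥0) (i : Fin n) :
    ∫ x, x i ∂complexGaussianVec n v = 0 := by
  have hmp := measurePreserving_eval (fun _ : Fin n => complexGaussian v) i
  have h := integral_map (μ := complexGaussianVec n v) (f := fun z : ℂ => z)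
    (measurable_pi_apply i).aemeasurable (by fun_prop)
  rw [← h, complexGaussianVec, hmp.map_eq, integral_id_complexGaussian]

theorem integral_star_eval_mul_eval_complexGaussianVec {n : ℕ} (v : ℝ≥0) (i j : Fin n) :
    ∫ x, star (x i) * x j ∂complexGaussianVec n v = if i = j then (v : ℂ) else 0 := by
  split_ifs with hij
  · subst hij
    have hmp := measurePreserving_eval (fun _ : Fin n => complexGaussian v) i
    have h := integral_map (μ := complexGaussianVec n v) (f := fun z : ℂ => star z * z)
      (measurable_pi_apply i).aemeasurable (by fun_prop)
    rw [← h, complexGaussianVec, hmp.map_eq]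
    have h2 : ∀ z : ℂ, star z * z = ((‖z‖ ^ 2 : ℝ) : ℂ) := fun z => by
      rw [← Complex.normSq_eq_norm_sq, Complex.normSq_eq_conj_mul_self]; rfl
    simp_rw [h2]
    rw [integral_complex_ofReal, integral_norm_sq_complexGaussian]
  · have hind := (iIndepFun_pi (μ := fun _ : Fin n => complexGaussian v)
      (X := fun _ (z : ℂ) => z) fun _ => aemeasurable_id).indepFun hij
    have hind' := hind.comp (φ := fun z : ℂ => star z) (ψ := fun z => z)
      continuous_star.measurable measurable_id
    have h := hind'.integral_fun_mul_eq_mul_integral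
      (continuous_star.measurable.comp (measurable_pi_apply i)).aestronglyMeasurable
      (measurable_pi_apply j).aestronglyMeasurable
    simp only [Function.comp] at h
    have h0 : ∫ x : Fin n → ℂ, x j ∂(Measure.pi fun _ => complexGaussian v) = 0 :=
      integral_eval_complexGaussianVec v j
    rw [complexGaussianVec, h, h0, mul_zero]

variable {Ω : Type*} {mΩ : MeasurableSpace Ω} {P : Measure Ω} {a b : ℕ}
  {u : Ω → Fin a → ℂ} {w : Ω → Fin b → ℂ}

theorem star_dotProduct_mulVec_eq_sum (A : Matrix (Fin a) (Fin b) ℂ) (p : Fin a → ℂ)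
    (q : Fin b → ℂ) : star p ⬝ᵥ (A *ᵥ q) = ∑ i, ∑ j, A i j * (star (p i) * q j) := by
  simp only [dotProduct, mulVec, Finset.mul_sum, Pi.star_apply]
  exact Finset.sum_congr rfl fun i _ => Finset.sum_congr rfl fun j _ => by ring

theorem integrable_star_mul (hu : ∀ i, MemLp (fun ω => u ω i) 2 P)
    (hw : ∀ j, MemLp (fun ω => w ω j) 2 P) (i : Fin a) (j : Fin b) :
    Integrable (fun ω => star (u ω i) * w ω j) P :=
  (hu i).star.integrable_mul (hw j)

theorem integrable_star_dotProduct_mulVec (hu : ∀ i, MemLp (fun ω => u ω i) 2 P)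
    (hw : ∀ j, MemLp (fun ω => w ω j) 2 P) (A : Matrix (Fin a) (Fin b) ℂ) :
    Integrable (fun ω => star (u ω) ⬝ᵥ (A *ᵥ w ω)) P := by
  simp_rw [star_dotProduct_mulVec_eq_sum]
  exact integrable_finsetSum _ fun i _ => integrable_finsetSum _ fun j _ =>
    (integrable_star_mul hu hw i j).const_mul _

theorem integral_star_dotProduct_mulVec (hu : ∀ i, MemLp (fun ω => u ω i) 2 P)
    (hw : ∀ j, MemLp (fun ω => w ω j) 2 P) (A : Matrix (Fin a) (Fin b) ℂ) :
    ∫ ω, star (u ω) ⬝ᵥ (A *ᵥ w ω) ∂P = ∑ i, ∑ j, A i j * ∫ ω, star (u ω i) * w ω j ∂P := by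
  simp_rw [star_dotProduct_mulVec_eq_sum]
  have hi (i : Fin a) (j : Fin b) := (integrable_star_mul hu hw i j).const_mul (A i j)
  rw [integral_finsetSum _ fun i _ => integrable_finsetSum _ fun j _ => hi i j]
  refine Finset.sum_congr rfl fun i _ => ?_
  rw [integral_finsetSum _ fun j _ => hi i j]
  exact Finset.sum_congr rfl fun j _ => integral_const_mul _ _

end Moments

/-! ### The rate as a function of the receiver matrices. -/

section GmiFormula

variable {nR nT : ℕ} (N0 : ℝ≥0)

/-- The joint law of input and noise. -/
def inputNoiseLaw (nR nT : ℕ) (N0 : ℝ≥0) : Measure ((Fin nT → ℂ) × (Fin nR → ℂ)) :=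
  (complexGaussianVec nT 1).prod (complexGaussianVec nR N0)

theorem memLp_input (i : Fin nT) : MemLp (fun z => z.1 i) 2 (inputNoiseLaw nR nT N0) :=
  (memLp_eval_complexGaussianVec 1 i).comp_measurePreserving measurePreserving_fst

theorem memLp_noise (i : Fin nR) : MemLp (fun z => z.2 i) 2 (inputNoiseLaw nR nT N0) :=
  (memLp_eval_complexGaussianVec N0 i).comp_measurePreserving measurePreserving_snd

theorem integral_input_input (A : Matrix (Fin nT) (Fin nT) ℂ) :
    ∫ z, star z.1 ⬝ᵥ (A *ᵥ z.1) ∂inputNoiseLaw nR nT N0 = A.trace := by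
  rw [integral_star_dotProduct_mulVec (memLp_input N0) (memLp_input N0), Matrix.trace]
  refine Finset.sum_congr rfl fun i _ => ?_
  have h (j : Fin nT) : ∫ z, star (z.1 i) * z.1 j ∂inputNoiseLaw nR nT N0 =
      if i = j then 1 else 0 := by
    rw [inputNoiseLaw, integral_fun_fst (fun x : Fin nT → ℂ => star (x i) * x j),
      integral_star_eval_mul_eval_complexGaussianVec]
    simp
  simp only [h]
  simp

theorem integral_noise_noise (A : Matrix (Fin nR) (Fin nR) ℂ) :
    ∫ z, star z.2 ⬝ᵥ (A *ᵥ z.2) ∂inputNoiseLaw nR nT N0 = N0 * A.trace := by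
  rw [integral_star_dotProduct_mulVec (memLp_noise N0) (memLp_noise N0), Matrix.trace,
    Finset.mul_sum]
  refine Finset.sum_congr rfl fun i _ => ?_
  have h (j : Fin nR) : ∫ z, star (z.2 i) * z.2 j ∂inputNoiseLaw nR nT N0 =
      if i = j then (N0 : ℂ) else 0 := by
    rw [inputNoiseLaw, integral_fun_snd (fun x : Fin nR → ℂ => star (x i) * x j),
      integral_star_eval_mul_eval_complexGaussianVec]
    simp
  simp only [h]
  simp [mul_comm]

theorem integral_input_noise (A : Matrix (Fin nT) (Fin nR) ℂ) :
    ∫ z, star z.1 ⬝ᵥ (A *ᵥ z.2) ∂inputNoiseLaw nR nT N0 = 0 := by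
  rw [integral_star_dotProduct_mulVec (memLp_input N0) (memLp_noise N0)]
  refine Finset.sum_eq_zero fun i _ => Finset.sum_eq_zero fun j _ => ?_
  rw [inputNoiseLaw, integral_prod_mul (fun x : Fin nT → ℂ => star (x i))
    (fun x : Fin nR → ℂ => x j), integral_eval_complexGaussianVec, mul_zero, mul_zero]

theorem integral_noise_input (A : Matrix (Fin nR) (Fin nT) ℂ) :
    ∫ z, star z.2 ⬝ᵥ (A *ᵥ z.1) ∂inputNoiseLaw nR nT N0 = 0 := by
  rw [integral_star_dotProduct_mulVec (memLp_noise N0) (memLp_input N0)]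
  refine Finset.sum_eq_zero fun i _ => Finset.sum_eq_zero fun j _ => ?_
  simp_rw [mul_comm (star _)]
  rw [inputNoiseLaw, integral_prod_mul (fun x : Fin nT → ℂ => x j)
    (fun x : Fin nR → ℂ => star (x i)), integral_eval_complexGaussianVec, zero_mul, mul_zero]

theorem integral_output_output (H : Matrix (Fin nR) (Fin nT) ℂ) (Q : Matrix (Fin nR) (Fin nR) ℂ) :
    Integrable (fun z => star (H *ᵥ z.1 + z.2) ⬝ᵥ (Q *ᵥ (H *ᵥ z.1 + z.2)))
      (inputNoiseLaw nR nT N0) ∧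
    ∫ z, star (H *ᵥ z.1 + z.2) ⬝ᵥ (Q *ᵥ (H *ᵥ z.1 + z.2)) ∂inputNoiseLaw nR nT N0 =
      (Q * (H * Hᴴ + (N0 : ℂ) • 1)).trace := by
  have hx := memLp_input (nR := nR) (nT := nT) N0
  have hn := memLp_noise (nR := nR) (nT := nT) N0
  have h (z : (Fin nT → ℂ) × (Fin nR → ℂ)) :
      star (H *ᵥ z.1 + z.2) ⬝ᵥ (Q *ᵥ (H *ᵥ z.1 + z.2)) =
        (star z.1 ⬝ᵥ ((Hᴴ * Q * H) *ᵥ z.1) + star z.1 ⬝ᵥ ((Hᴴ * Q) *ᵥ z.2)) +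
        (star z.2 ⬝ᵥ ((Q * H) *ᵥ z.1) + star z.2 ⬝ᵥ (Q *ᵥ z.2)) := by
    rw [star_add, add_dotProduct, mulVec_add, dotProduct_add, dotProduct_add, star_mulVec,
      ← dotProduct_mulVec, ← dotProduct_mulVec, mulVec_mulVec, mulVec_mulVec, mulVec_mulVec,
      mulVec_mulVec, Matrix.mul_assoc]
  have i1 := integrable_star_dotProduct_mulVec hx hx (Hᴴ * Q * H)
  have i2 := integrable_star_dotProduct_mulVec hx hn (Hᴴ * Q)
  have i3 := integrable_star_dotProduct_mulVec hn hx (Q * H)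
  have i4 := integrable_star_dotProduct_mulVec hn hn Q
  simp_rw [h]
  refine ⟨(i1.add i2).add (i3.add i4), ?_⟩
  have i12 : Integrable (fun z => star z.1 ⬝ᵥ ((Hᴴ * Q * H) *ᵥ z.1) +
    star z.1 ⬝ᵥ ((Hᴴ * Q) *ᵥ z.2)) (inputNoiseLaw nR nT N0) := i1.add i2
  have i34 : Integrable (fun z => star z.2 ⬝ᵥ ((Q * H) *ᵥ z.1) + star z.2 ⬝ᵥ (Q *ᵥ z.2))
    (inputNoiseLaw nR nT N0) := i3.add i4
  rw [integral_add i12 i34, integral_add i1 i2, integral_add i3 i4,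
    integral_input_input, integral_input_noise, integral_noise_input, integral_noise_noise,
    mul_add, trace_add, Matrix.mul_smul, mul_one, trace_smul, add_zero, zero_add, smul_eq_mul,
    Matrix.mul_assoc, Matrix.trace_mul_comm, Matrix.mul_assoc]

theorem integral_input_output (H : Matrix (Fin nR) (Fin nT) ℂ) (A : Matrix (Fin nT) (Fin nR) ℂ) :
    Integrable (fun z => star z.1 ⬝ᵥ (A *ᵥ (H *ᵥ z.1 + z.2))) (inputNoiseLaw nR nT N0) ∧
    ∫ z, star z.1 ⬝ᵥ (A *ᵥ (H *ᵥ z.1 + z.2)) ∂inputNoiseLaw nR nT N0 = (A * H).trace := by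
  have hx := memLp_input (nR := nR) (nT := nT) N0
  have hn := memLp_noise (nR := nR) (nT := nT) N0
  have h (z : (Fin nT → ℂ) × (Fin nR → ℂ)) : star z.1 ⬝ᵥ (A *ᵥ (H *ᵥ z.1 + z.2)) =
      star z.1 ⬝ᵥ ((A * H) *ᵥ z.1) + star z.1 ⬝ᵥ (A *ᵥ z.2) := by
    rw [mulVec_add, dotProduct_add, mulVec_mulVec]
  have i1 := integrable_star_dotProduct_mulVec hx hx (A * H)
  have i2 := integrable_star_dotProduct_mulVec hx hn A
  simp_rw [h]
  refine ⟨i1.add i2, ?_⟩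
  rw [integral_add i1 i2, integral_input_input, integral_input_noise, add_zero]

/-- Closed form of the generalized mutual information. -/
theorem gmi_eq {H : Matrix (Fin nR) (Fin nT) ℂ} {Hr : Matrix (Fin nT) (Fin nR) ℂ}
    {G : Matrix (Fin nT) (Fin nT) ℂ} (hG : G.IsHermitian) (hF : (1 + G).PosDef) :
    gmi H N0 Hr G = Real.log (1 + G).det.re -
      (Hrᴴ * (1 + G)⁻¹ * Hr * (H * Hᴴ + (N0 : ℂ) • 1)).trace.re +
      (2 * (Hr * H).trace.re - G.trace.re) := by
  obtain ⟨i1, e1⟩ := integral_output_output N0 H (Hrᴴ * (1 + G)⁻¹ * Hr)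
  obtain ⟨i2, e2⟩ := integral_input_output N0 H Hr
  have i3 := integrable_star_dotProduct_mulVec (memLp_input (nR := nR) (nT := nT) N0)
    (memLp_input N0) G
  have e3 := integral_input_input (nR := nR) N0 G
  have hq (y : Fin nR → ℂ) : (star (Hr *ᵥ y) ⬝ᵥ ((1 + G)⁻¹ *ᵥ (Hr *ᵥ y))).re =
      RCLike.re (star y ⬝ᵥ ((Hrᴴ * (1 + G)⁻¹ * Hr) *ᵥ y)) := by
    rw [star_mulVec, ← dotProduct_mulVec, mulVec_mulVec, mulVec_mulVec, Matrix.mul_assoc]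
    rfl
  have p1 := i1.re
  have p2 : Integrable (fun z : (Fin nT → ℂ) × (Fin nR → ℂ) =>
    RCLike.re (star z.1 ⬝ᵥ (Hr *ᵥ (H *ᵥ z.1 + z.2)))) (inputNoiseLaw nR nT N0) := i2.re
  have p3 : Integrable (fun z : (Fin nT → ℂ) × (Fin nR → ℂ) =>
    RCLike.re (star z.1 ⬝ᵥ (G *ᵥ z.1))) (inputNoiseLaw nR nT N0) := i3.re
  have : IsProbabilityMeasure (inputNoiseLaw nR nT N0) := by
    unfold inputNoiseLaw; infer_instance
  rw [gmi, ← inputNoiseLaw]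
  simp_rw [log_receiverMarginal hG hF, receiverFun, Real.log_exp, hq]
  rw [integral_add (integrable_const _) p1, integral_re i1, e1]
  simp only [← RCLike.re_eq_complex_re]
  rw [integral_sub (p2.const_mul 2) p3, integral_const_mul, integral_re i2, e2, integral_re i3, e3]
  simp
  ring

end GmiFormula

/-! ### Determinant and trace inequalities; minors of an inverse. -/

section MatrixInequalities

variable {n : Type*} [Fintype n] [DecidableEq n]

theorem _root_.Matrix.PosDef.det_re_pos {A : Matrix n n ℂ} (hA : A.PosDef) : 0 < A.det.re :=
  (Complex.pos_iff.mp hA.det_pos).1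

theorem _root_.Matrix.PosDef.det_im {A : Matrix n n ℂ} (hA : A.PosDef) : A.det.im = 0 :=
  (Complex.pos_iff.mp hA.det_pos).2.symm

theorem _root_.Matrix.PosDef.exists_eq_conjTranspose_mul_self {A : Matrix n n ℂ} (hA : A.PosDef) :
    ∃ C : Matrix n n ℂ, A = Cᴴ * C := by
  open scoped MatrixOrder in
  exact CStarAlgebra.nonneg_iff_eq_star_mul_self.mp hA.posSemidef.nonneg

theorem log_det_le_trace_sub {P : Matrix n n ℂ} (hP : P.PosDef) :
    Real.log P.det.re ≤ P.trace.re - Fintype.card n := by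
  have hdet : P.det.re = ∏ i, hP.1.eigenvalues i := by
    rw [hP.1.det_eq_prod_eigenvalues]
    change (∏ i, ((hP.1.eigenvalues i : ℝ) : ℂ)).re = _
    rw [← Complex.ofReal_prod, Complex.ofReal_re]
  have htr : P.trace.re = ∑ i, hP.1.eigenvalues i := by
    rw [hP.1.trace_eq_sum_eigenvalues, Complex.re_sum]
    rfl
  rw [hdet, htr, Real.log_prod fun i _ => (hP.eigenvalues_pos i).ne', Fintype.card,
    Finset.card_eq_sum_ones, Nat.cast_sum, ← Finset.sum_sub_distrib]
  refine Finset.sum_le_sum fun i _ => ?_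
  simpa using Real.log_le_sub_one_of_pos (hP.eigenvalues_pos i)

/-- Writing F = CᴴC, this is `log_det_le_trace_sub` for C D Cᴴ, which has determinant det F · det D
and trace tr(F D). Equality holds at F = D⁻¹, the optimal choice later. -/
theorem log_det_sub_trace_mul_le {F D : Matrix n n ℂ} (hF : F.PosDef) (hD : D.PosDef) :
    Real.log F.det.re + Fintype.card n - (F * D).trace.re ≤ -Real.log D.det.re := by
  obtain ⟨C, rfl⟩ := hF.exists_eq_conjTranspose_mul_self
  have hC : IsUnit C := by
    have := hF.isUnit
    rw [isUnit_iff_isUnit_det, det_mul] at this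
    exact (isUnit_iff_isUnit_det C).mpr (isUnit_of_mul_isUnit_right this)
  have hP : (C * D * Cᴴ).PosDef :=
    (Matrix.IsUnit.posDef_star_right_conjugate_iff hC).mpr hD
  have h := log_det_le_trace_sub hP
  have hdet : (C * D * Cᴴ).det = (Cᴴ * C).det * D.det := by
    rw [det_mul, det_mul, det_mul]; ring
  rw [hdet, Complex.mul_re, hD.det_im, mul_zero, sub_zero,
    Real.log_mul hF.det_re_pos.ne' hD.det_re_pos.ne', Matrix.trace_mul_cycle] at h
  linarith

theorem log_det_inv_re {D : Matrix n n ℂ} (hD : D.PosDef) :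
    Real.log (D⁻¹).det.re = -Real.log D.det.re := by
  have h : ((D.det.re : ℝ) : ℂ) = D.det := Complex.ext rfl hD.det_im.symm
  rw [det_nonsing_inv, Ring.inverse_eq_inv', ← h, ← Complex.ofReal_inv, Complex.ofReal_re,
    Real.log_inv, h]

theorem trace_completed_square_nonneg {m : Type*} [Fintype m] [DecidableEq m]
    {Q : Matrix n n ℂ} {R : Matrix m m ℂ} (hQ : Q.PosDef) (hR : R.PosDef) (E : Matrix n m ℂ) :
    0 ≤ (Eᴴ * Q * E * R).trace.re := by
  obtain ⟨C, rfl⟩ := hR.exists_eq_conjTranspose_mul_self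
  have h := ((hQ.posSemidef.conjTranspose_mul_mul_same E).mul_mul_conjTranspose_same C).trace_nonneg
  have h2 : (Eᴴ * Q * E * (Cᴴ * C)).trace = (C * (Eᴴ * Q * E) * Cᴴ).trace := by
    rw [← Matrix.mul_assoc, Matrix.trace_mul_comm, ← Matrix.mul_assoc]
  rw [h2]
  exact (Complex.nonneg_iff.mp h).1

/-- For fixed F the rate is a concave quadratic in Hr. This isolates its maximizer F Hᴴ R⁻¹; the
remainder is nonnegative by `trace_completed_square_nonneg`. -/
theorem completed_square {m : Type*} [Fintype m] [DecidableEq m] {F : Matrix n n ℂ}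
    {R : Matrix m m ℂ} (hF : F.PosDef) (hR : R.PosDef) (H : Matrix m n ℂ) (Hr : Matrix n m ℂ) :
    2 * (Hr * H).trace.re - (Hrᴴ * F⁻¹ * Hr * R).trace.re =
      (F * (Hᴴ * R⁻¹ * H)).trace.re -
        ((Hr - F * Hᴴ * R⁻¹)ᴴ * F⁻¹ * (Hr - F * Hᴴ * R⁻¹) * R).trace.re := by
  have hFi : F⁻¹ * F = 1 := nonsing_inv_mul _ ((isUnit_iff_isUnit_det _).mp hF.isUnit)
  have hFi' : F * F⁻¹ = 1 := mul_nonsing_inv _ ((isUnit_iff_isUnit_det _).mp hF.isUnit)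
  have hRi : R⁻¹ * R = 1 := nonsing_inv_mul _ ((isUnit_iff_isUnit_det _).mp hR.isUnit)
  have hE : (Hr - F * Hᴴ * R⁻¹)ᴴ * F⁻¹ * (Hr - F * Hᴴ * R⁻¹) * R =
      Hrᴴ * F⁻¹ * Hr * R - Hrᴴ * Hᴴ - R⁻¹ * H * Hr * R + R⁻¹ * (H * F * Hᴴ) := by
    rw [conjTranspose_sub, conjTranspose_mul, conjTranspose_mul, conjTranspose_conjTranspose,
      hF.1.eq, hR.inv.1.eq]
    calc _ = Hrᴴ * F⁻¹ * Hr * R - Hrᴴ * (F⁻¹ * F) * Hᴴ * (R⁻¹ * R) -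
          R⁻¹ * H * (F * F⁻¹) * Hr * R + R⁻¹ * H * (F * F⁻¹) * F * Hᴴ * (R⁻¹ * R) := by
          simp only [Matrix.sub_mul, Matrix.mul_sub, Matrix.mul_assoc]
          abel
      _ = _ := by rw [hFi, hFi', hRi]; simp only [Matrix.mul_one, Matrix.mul_assoc]
  have t1 : (Hrᴴ * Hᴴ).trace.re = (Hr * H).trace.re := by
    rw [← conjTranspose_mul, trace_conjTranspose, Matrix.trace_mul_comm]
    simp
  have t2 : (R⁻¹ * H * Hr * R).trace = (Hr * H).trace := by
    rw [Matrix.trace_mul_comm, Matrix.mul_assoc R⁻¹, ← Matrix.mul_assoc R,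
      mul_nonsing_inv _ ((isUnit_iff_isUnit_det _).mp hR.isUnit), Matrix.one_mul,
      Matrix.trace_mul_comm]
  have t3 : (R⁻¹ * (H * F * Hᴴ)).trace = (F * (Hᴴ * R⁻¹ * H)).trace := by
    rw [Matrix.trace_mul_comm, Matrix.mul_assoc, Matrix.mul_assoc, Matrix.trace_mul_comm]
    simp only [Matrix.mul_assoc]
  rw [hE, trace_add, trace_sub, trace_sub, t2, t3]
  simp only [Complex.add_re, Complex.sub_re, t1]
  ring

/-- Complementary minors of an inverse matrix. -/
theorem det_toSquareBlockProp_inv_mul_det {A : Matrix n n ℂ} (hA : IsUnit A) (p : n → Prop)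
    [DecidablePred p] :
    (A⁻¹.toSquareBlockProp p).det * A.det = (A.toSquareBlockProp fun i => ¬p i).det := by
  have hAi : A * A⁻¹ = 1 := mul_nonsing_inv _ ((isUnit_iff_isUnit_det _).mp hA)
  -- N takes the columns in p from A⁻¹ and the others from 1, so A N takes them from 1 and A
  -- respectively. Both are block triangular, and det(A N) = det A · det N compares the two minors.
  let N : Matrix n n ℂ := of fun i j => if p j then A⁻¹ i j else (1 : Matrix n n ℂ) i j
  have hAN (i j : n) : (A * N) i j = if p j then (1 : Matrix n n ℂ) i j else A i j := by
    rw [mul_apply]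
    split_ifs with hj
    · rw [← hAi, mul_apply]
      simp [N, hj]
    · conv_rhs => rw [← Matrix.mul_one A, mul_apply]
      simp [N, hj]
  have h1 := twoBlockTriangular_det (A * N) p fun i hi j hj => by
    rw [hAN, if_pos hj, one_apply_ne]
    rintro rfl
    exact hi hj
  have h2 := twoBlockTriangular_det' N p fun i hi j hj => by
    simp only [N, of_apply, if_neg hj]
    rw [one_apply_ne]
    rintro rfl
    exact hj hi
  have e1 : (A * N).toSquareBlockProp p = 1 := by
    ext i j
    simp [toSquareBlockProp_def, hAN, j.2, one_apply, Subtype.ext_iff]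
  have e2 : (A * N).toSquareBlockProp (fun i => ¬p i) = A.toSquareBlockProp fun i => ¬p i := by
    ext i j
    simp [toSquareBlockProp_def, hAN, j.2]
  have e3 : N.toSquareBlockProp p = A⁻¹.toSquareBlockProp p := by
    ext i j
    simp [toSquareBlockProp_def, N, j.2]
  have e4 : N.toSquareBlockProp (fun i => ¬p i) = 1 := by
    ext i j
    simp [toSquareBlockProp_def, N, j.2, one_apply, Subtype.ext_iff]
  rw [e1, e2, det_one, one_mul, det_mul] at h1
  rw [e3, e4, det_one, mul_one] at h2
  rw [← h1, h2, mul_comm]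

end MatrixInequalities

/-! ### The block diagonal part of a positive definite matrix. -/

section BlockDiagonalPart

variable {n : Type*} [Fintype n] [DecidableEq n] {M : ℕ} (b : n → Fin M)

/-- The block diagonal part of a matrix with respect to a block labelling. -/
def blockDiagPart (B : Matrix n n ℂ) : Matrix n n ℂ := of fun i j => if b i = b j then B i j else 0

theorem blockTriangular_blockDiagPart (B : Matrix n n ℂ) : (blockDiagPart b B).BlockTriangular b :=
  fun i j hij => by simp [blockDiagPart, hij.ne']

theorem det_blockDiagPart (B : Matrix n n ℂ) :
    (blockDiagPart b B).det = ∏ m, (B.toSquareBlock b m).det := by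
  rw [(blockTriangular_blockDiagPart b B).det_fintype]
  refine Finset.prod_congr rfl fun m _ => ?_
  congr 1
  ext i j
  simp [toSquareBlock_def, blockDiagPart, i.2, j.2]

theorem posDef_toSquareBlock {B : Matrix n n ℂ} (hB : B.PosDef) (m : Fin M) :
    (B.toSquareBlock b m).PosDef :=
  hB.submatrix Subtype.val_injective

/-- Extracting the blocks is a Hadamard product with the Gram matrix of block indicators, so the
Schur product theorem gives semidefiniteness. Definiteness follows because every diagonal block has
nonzero determinant. -/
theorem posDef_blockDiagPart {B : Matrix n n ℂ} (hB : B.PosDef) : (blockDiagPart b B).PosDef := by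
  let Z : Matrix n (Fin M) ℂ := of fun i m => if b i = m then 1 else 0
  have hZ : blockDiagPart b B = B ⊙ (Z * Zᴴ) := by
    ext i j
    by_cases hij : b i = b j
    · simp [blockDiagPart, Z, mul_apply, hij]
    · simp [blockDiagPart, Z, mul_apply, hij]
  have hpsd : (blockDiagPart b B).PosSemidef := by
    rw [hZ]
    exact hB.posSemidef.hadamard (posSemidef_self_mul_conjTranspose Z)
  rw [hpsd.posDef_iff_det_ne_zero, det_blockDiagPart]
  exact Finset.prod_ne_zero_iff.mpr fun m _ => (posDef_toSquareBlock b hB m).det_pos.ne'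

theorem trace_mul_blockDiagPart {F : Matrix n n ℂ} (hF : ∀ i j, b i ≠ b j → F i j = 0)
    (B : Matrix n n ℂ) : (F * B).trace = (F * blockDiagPart b B).trace := by
  simp only [Matrix.trace, diag_apply, mul_apply, blockDiagPart, of_apply]
  refine Finset.sum_congr rfl fun i _ => Finset.sum_congr rfl fun j _ => ?_
  by_cases hij : b j = b i
  · simp [hij]
  · simp [hF i j (Ne.symm hij)]

/-- Inverses of block triangular matrices are block triangular, which handles one side of the
diagonal; Hermitian symmetry handles the other. Hence the optimal G is admissible. -/
theorem inv_blockDiagPart_apply {B : Matrix n n ℂ} (hB : B.PosDef) {i j : n} (hij : b i ≠ b j) :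
    (blockDiagPart b B)⁻¹ i j = 0 := by
  have hD := posDef_blockDiagPart b hB
  have := hD.isUnit.invertible
  have ht := blockTriangular_inv_of_blockTriangular (blockTriangular_blockDiagPart b B)
  rcases lt_or_gt_of_ne hij with h | h
  · have hs := hD.inv.1.apply i j
    rw [ht h, star_zero] at hs
    exact hs.symm
  · exact ht h

theorem log_det_blockDiagPart_inv {A : Matrix n n ℂ} (hA : A.PosDef) :
    -Real.log (blockDiagPart b A⁻¹).det.re =
      ∑ m, (Real.log A.det.re - Real.log (A.toSquareBlockProp fun i => ¬b i = m).det.re) := by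
  have hre (m : Fin M) : (((A⁻¹.toSquareBlock b m).det.re : ℝ) : ℂ) =
      (A⁻¹.toSquareBlock b m).det :=
    Complex.ext rfl (posDef_toSquareBlock b hA.inv m).det_im.symm
  have hpos (m : Fin M) := (posDef_toSquareBlock b hA.inv m).det_re_pos
  rw [det_blockDiagPart, ← Finset.prod_congr rfl fun m _ => hre m, ← Complex.ofReal_prod, Complex.ofReal_re, Real.log_prod fun m _ => (hpos m).ne',
    ← Finset.sum_neg_distrib]
  refine Finset.sum_congr rfl fun m _ => ?_
  have h : (A⁻¹.toSquareBlock b m).det * A.det = _ :=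
    det_toSquareBlockProp_inv_mul_det hA.isUnit (fun i => b i = m)
  rw [← h, Complex.mul_re, hA.det_im, mul_zero, sub_zero,
    Real.log_mul (hpos m).ne' hA.det_re_pos.ne']
  ring

end BlockDiagonalPart

/-! ### The optimal receiver and its rate. -/

section Optimum

variable {nR : ℕ} {n : Type*} [Fintype n] [DecidableEq n]

/-- `log det (I + ρ Hᴴ H)`. -/
def logDetGram (ρ : ℝ) (H : Matrix (Fin nR) n ℂ) : ℝ :=
  Real.log (1 + (ρ : ℂ) • (Hᴴ * H)).det.re

theorem posSemidef_smul_gram {ρ : ℝ} (hρ : 0 ≤ ρ) (H : Matrix (Fin nR) n ℂ) :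
    ((ρ : ℂ) • (Hᴴ * H)).PosSemidef :=
  (posSemidef_conjTranspose_mul_self H).smul (Complex.zero_le_real.mpr hρ)

theorem posDef_one_add_smul_gram {ρ : ℝ} (hρ : 0 ≤ ρ) (H : Matrix (Fin nR) n ℂ) :
    (1 + (ρ : ℂ) • (Hᴴ * H)).PosDef :=
  PosDef.one.add_posSemidef (posSemidef_smul_gram hρ H)

theorem posDef_output_covariance {N0 : ℝ≥0} (hN : 0 < N0) (H : Matrix (Fin nR) n ℂ) :
    (H * Hᴴ + (N0 : ℂ) • 1).PosDef := by
  refine PosDef.posSemidef_add (posSemidef_self_mul_conjTranspose H) (PosDef.one.smul ?_)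
  exact Complex.zero_lt_real.mpr (NNReal.coe_pos.mpr hN)

/-- The error matrix of linear minimum mean square error estimation. -/
theorem inv_one_add_smul_gram {N0 : ℝ≥0} (hN : 0 < N0) (H : Matrix (Fin nR) n ℂ) :
    (1 + (((N0 : ℝ)⁻¹ : ℝ) : ℂ) • (Hᴴ * H))⁻¹ = 1 - Hᴴ * (H * Hᴴ + (N0 : ℂ) • 1)⁻¹ * H := by
  refine inv_eq_right_inv ?_
  set R := H * Hᴴ + (N0 : ℂ) • (1 : Matrix (Fin nR) (Fin nR) ℂ) with hR
  have hRR : R * R⁻¹ = 1 :=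
    mul_nonsing_inv _ ((isUnit_iff_isUnit_det _).mp (posDef_output_covariance hN H).isUnit)
  have hN' : (N0 : ℂ) ≠ 0 := by exact_mod_cast hN.ne'
  -- Substituting HHᴴ = R - N0·1 in the middle lets R cancel R⁻¹.
  have h1 : (Hᴴ * H) * (Hᴴ * R⁻¹ * H) = Hᴴ * H - (N0 : ℂ) • (Hᴴ * R⁻¹ * H) := by
    have h2 : H * Hᴴ = R - (N0 : ℂ) • 1 := by rw [hR, add_sub_cancel_right]
    calc (Hᴴ * H) * (Hᴴ * R⁻¹ * H) = Hᴴ * (H * Hᴴ) * R⁻¹ * H := by simp only [Matrix.mul_assoc]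
      _ = Hᴴ * ((R - (N0 : ℂ) • 1) * R⁻¹) * H := by rw [h2]; simp only [Matrix.mul_assoc]
      _ = _ := by
        rw [Matrix.sub_mul, hRR, Matrix.smul_mul, Matrix.one_mul, Matrix.mul_sub, Matrix.mul_one,
          Matrix.sub_mul, Matrix.mul_smul, Matrix.smul_mul]
  rw [Matrix.mul_sub, Matrix.mul_one, Matrix.add_mul, Matrix.one_mul, Matrix.smul_mul, h1,
    smul_sub, smul_smul, Complex.ofReal_inv, inv_mul_cancel₀ hN', one_smul]
  abel

/-- A principal submatrix of a Gram matrix is the Gram matrix of the selected columns, so the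
complementary minors are again log-determinants of channels. -/
theorem toSquareBlockProp_one_add_smul_gram (ρ : ℂ) (H : Matrix (Fin nR) n ℂ) (p : n → Prop) :
    (1 + ρ • (Hᴴ * H)).toSquareBlockProp p =
      1 + ρ • ((H.submatrix id (Subtype.val : {i // p i} → n))ᴴ *
        H.submatrix id (Subtype.val : {i // p i} → n)) := by
  ext i j
  simp [toSquareBlockProp_def, mul_apply, one_apply, Subtype.ext_iff]

variable {nT M : ℕ} {K : Fin M → ℕ} {b : Fin nT → Fin M}

/-- The maximal rate, in closed form. -/
theorem isGreatest_blockGmiValues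
    (hb : ∀ G : Matrix (Fin nT) (Fin nT) ℂ, IsBlockDiag K G ↔ ∀ i j, b i ≠ b j → G i j = 0)
    (H : Matrix (Fin nR) (Fin nT) ℂ) {N0 : ℝ≥0} (hN : 0 < N0) :
    IsGreatest (blockGmiValues K H N0)
      (∑ m, (logDetGram (N0 : ℝ)⁻¹ H -
        logDetGram (N0 : ℝ)⁻¹ (H.submatrix id (Subtype.val : {i // ¬b i = m} → Fin nT)))) := by
  have hR := posDef_output_covariance hN H
  have hA := posDef_one_add_smul_gram (inv_nonneg.mpr N0.coe_nonneg) H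
  have hval := log_det_blockDiagPart_inv b hA
  simp_rw [toSquareBlockProp_one_add_smul_gram] at hval
  have hB := hA.inv
  have hBeq := inv_one_add_smul_gram hN H
  set A := 1 + (((N0 : ℝ)⁻¹ : ℝ) : ℂ) • (Hᴴ * H) with hAdef
  set R := H * Hᴴ + (N0 : ℂ) • (1 : Matrix (Fin nR) (Fin nR) ℂ) with hRdef
  have hD := posDef_blockDiagPart b hB
  have hvalue : ∑ m, (logDetGram (N0 : ℝ)⁻¹ H -
      logDetGram (N0 : ℝ)⁻¹ (H.submatrix id (Subtype.val : {i // ¬b i = m} → Fin nT))) =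
      -Real.log (blockDiagPart b A⁻¹).det.re := hval.symm
  have hgmi {Hr : Matrix (Fin nT) (Fin nR) ℂ} {G : Matrix (Fin nT) (Fin nT) ℂ}
      (hG : G.IsHermitian) (hGb : IsBlockDiag K G) (hF : (1 + G).PosDef) :
      gmi H N0 Hr G = Real.log (1 + G).det.re + nT - ((1 + G) * blockDiagPart b A⁻¹).trace.re -
        ((Hr - (1 + G) * Hᴴ * R⁻¹)ᴴ * (1 + G)⁻¹ * (Hr - (1 + G) * Hᴴ * R⁻¹) * R).trace.re := by
    have hFb : ∀ i j, b i ≠ b j → (1 + G) i j = 0 := fun i j hij => by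
      rw [Matrix.add_apply, (hb G).mp hGb i j hij, one_apply_ne (fun h => hij (congrArg b h)), add_zero]
    have hsq := completed_square hF hR H Hr
    have htr : ((1 + G) * (Hᴴ * R⁻¹ * H)).trace.re =
        nT + G.trace.re - ((1 + G) * blockDiagPart b A⁻¹).trace.re := by
      rw [← trace_mul_blockDiagPart b hFb, hBeq, Matrix.mul_sub, Matrix.mul_one, trace_sub,
        trace_add, trace_one]
      simp
    rw [gmi_eq N0 hG hF]
    linarith
  rw [hvalue]
  constructor
  -- Attainment: F = D⁻¹, so G = D⁻¹ - 1, and Hr = F Hᴴ R⁻¹ makes the square vanish.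
  · have hDi := hD.inv
    have hF : 1 + ((blockDiagPart b A⁻¹)⁻¹ - 1) = (blockDiagPart b A⁻¹)⁻¹ := add_sub_cancel _ _
    have hG : ((blockDiagPart b A⁻¹)⁻¹ - 1).IsHermitian := hDi.1.sub isHermitian_one
    have hGb : IsBlockDiag K ((blockDiagPart b A⁻¹)⁻¹ - 1) := (hb _).mpr fun i j hij => by
      rw [Matrix.sub_apply, inv_blockDiagPart_apply b hB hij, one_apply_ne (fun h => hij (congrArg b h)),
        sub_zero]
    have hFpos : (1 + ((blockDiagPart b A⁻¹)⁻¹ - 1)).PosDef := by rwa [hF]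
    refine ⟨(1 + ((blockDiagPart b A⁻¹)⁻¹ - 1)) * Hᴴ * R⁻¹, (blockDiagPart b A⁻¹)⁻¹ - 1, hG, hGb,
      fun y => integrable_receiverFun hG hFpos _ y, ?_⟩
    rw [hgmi hG hGb hFpos, hF, log_det_inv_re hD,
      nonsing_inv_mul _ ((isUnit_iff_isUnit_det _).mp hD.isUnit)]
    simp
  · rintro r ⟨Hr, G, hG, hGb, hint, rfl⟩
    have hF := posDef_of_integrable_receiverFun hG Hr (hint 0)
    have h1 := log_det_sub_trace_mul_le hF hD
    have h2 := trace_completed_square_nonneg hF.inv hR (Hr - (1 + G) * Hᴴ * R⁻¹)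
    rw [Fintype.card_fin] at h1
    rw [hgmi hG hGb hF]
    linarith

end Optimum

/-! ### Growth of the log-determinant for a fixed channel. -/

section LogDetAsymptotics

variable {nR : ℕ} {n : Type*} [Fintype n] [DecidableEq n]

theorem det_one_add_smul_eq_prod {P : Matrix n n ℂ} (hP : P.IsHermitian) (ρ : ℝ) :
    (1 + (ρ : ℂ) • P).det = ((∏ i, (1 + ρ * hP.eigenvalues i) : ℝ) : ℂ) := by
  have h : 1 + (ρ : ℂ) • P = Unitary.conjStarAlgAut ℂ (Matrix n n ℂ) hP.eigenvectorUnitary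
      (diagonal fun i => ((1 + ρ * hP.eigenvalues i : ℝ) : ℂ)) := by
    have hd : (diagonal fun i => ((1 + ρ * hP.eigenvalues i : ℝ) : ℂ)) =
        1 + (ρ : ℂ) • diagonal (RCLike.ofReal ∘ hP.eigenvalues) := by
      rw [← diagonal_one, ← diagonal_smul, diagonal_add]
      congr 1
      funext i
      simp
    rw [hd, map_add, map_one, map_smul, ← hP.spectral_theorem]
  rw [h, Unitary.conjStarAlgAut_apply, det_mul_right_comm,
    ← Unitary.coe_star, Unitary.coe_mul_star_self, one_mul, det_diagonal, Complex.ofReal_prod]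

theorem isHermitian_gram (H : Matrix (Fin nR) n ℂ) : (Hᴴ * H).IsHermitian :=
  isHermitian_conjTranspose_mul_self H

theorem eigenvalues_gram_nonneg (H : Matrix (Fin nR) n ℂ) (i : n) :
    0 ≤ (isHermitian_gram H).eigenvalues i :=
  (posSemidef_conjTranspose_mul_self H).eigenvalues_nonneg i

theorem logDetGram_eq_sum {ρ : ℝ} (hρ : 0 ≤ ρ) (H : Matrix (Fin nR) n ℂ) :
    logDetGram ρ H = ∑ i, Real.log (1 + ρ * (isHermitian_gram H).eigenvalues i) := by
  rw [logDetGram, det_one_add_smul_eq_prod (isHermitian_gram H), Complex.ofReal_re, Real.log_prod]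
  intro i _
  have := mul_nonneg hρ (eigenvalues_gram_nonneg H i)
  positivity

theorem logDetGram_nonneg {ρ : ℝ} (hρ : 0 ≤ ρ) (H : Matrix (Fin nR) n ℂ) :
    0 ≤ logDetGram ρ H := by
  rw [logDetGram_eq_sum hρ]
  refine Finset.sum_nonneg fun i _ => Real.log_nonneg ?_
  linarith [mul_nonneg hρ (eigenvalues_gram_nonneg H i)]

/-- The squared Frobenius norm. -/
def frobeniusSq (H : Matrix (Fin nR) n ℂ) : ℝ := ∑ j, ∑ i, ‖H i j‖ ^ 2

theorem sum_eigenvalues_gram (H : Matrix (Fin nR) n ℂ) :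
    ∑ i, (isHermitian_gram H).eigenvalues i = frobeniusSq H := by
  have h : (Hᴴ * H).trace.re = ∑ i, (isHermitian_gram H).eigenvalues i := by
    rw [(isHermitian_gram H).trace_eq_sum_eigenvalues, Complex.re_sum]
    rfl
  rw [← h, frobeniusSq, Matrix.trace, Complex.re_sum]
  refine Finset.sum_congr rfl fun j _ => ?_
  rw [diag_apply, mul_apply, Complex.re_sum]
  refine Finset.sum_congr rfl fun i _ => ?_
  rw [← Complex.normSq_eq_norm_sq, Complex.normSq_apply]
  simp

theorem logDetGram_le {ρ : ℝ} (hρ : 0 ≤ ρ) (H : Matrix (Fin nR) n ℂ) :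
    logDetGram ρ H ≤ ρ * frobeniusSq H := by
  rw [logDetGram_eq_sum hρ, ← sum_eigenvalues_gram, Finset.mul_sum]
  refine Finset.sum_le_sum fun i _ => ?_
  have h := mul_nonneg hρ (eigenvalues_gram_nonneg H i)
  linarith [Real.log_le_sub_one_of_pos (show 0 < 1 + ρ * (isHermitian_gram H).eigenvalues i by
    linarith)]

/-- From 1 + sa ≤ s(1 + a) and log(1 + a) ≤ a; s ≥ e makes log s ≥ 1. The bound is uniform in s, as
domination requires. -/
theorem log_one_add_mul_div_log_le {s a : ℝ} (hs : Real.exp 1 ≤ s) (ha : 0 ≤ a) :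
    Real.log (1 + s * a) / Real.log s ≤ 1 + a := by
  have hs1 : 1 ≤ s := (Real.one_le_exp zero_le_one).trans hs
  have hs0 : 0 < s := by linarith
  have hl : 1 ≤ Real.log s := (Real.le_log_iff_exp_le hs0).mpr hs
  rw [div_le_iff₀ (by linarith)]
  have h1 : 1 + s * a ≤ s * (1 + a) := by nlinarith
  have h2 : Real.log (1 + s * a) ≤ Real.log s + Real.log (1 + a) := by
    rw [← Real.log_mul hs0.ne' (by positivity)]
    exact Real.log_le_log (by positivity) h1
  have h3 : Real.log (1 + a) ≤ a := by
    linarith [Real.log_le_sub_one_of_pos (show 0 < 1 + a by linarith)]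
  nlinarith

theorem tendsto_log_one_add_mul_div_log {a : ℝ} (ha : 0 < a) :
    Tendsto (fun s : ℝ => Real.log (1 + s * a) / Real.log s) atTop (𝓝 1) := by
  have h0 : Tendsto (fun s : ℝ => Real.log (s⁻¹ + a)) atTop (𝓝 (Real.log (0 + a))) :=
    (tendsto_inv_atTop_zero.add_const a).log (by linarith)
  have h1 := h0.div_atTop Real.tendsto_log_atTop
  have h2 := h1.const_add 1
  rw [add_zero] at h2
  refine h2.congr' ?_
  filter_upwards [eventually_gt_atTop 1] with s hs
  have hs0 : 0 < s := by linarith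
  have hl : Real.log s ≠ 0 := (Real.log_pos hs).ne'
  have h3 : 1 + s * a = s * (s⁻¹ + a) := by field_simp
  rw [h3, Real.log_mul hs0.ne' (by positivity)]
  field_simp

theorem logDetGram_div_log_le {s c : ℝ} (hs : Real.exp 1 ≤ s) (hc : 0 < c)
    (H : Matrix (Fin nR) n ℂ) :
    logDetGram (s / c) H / Real.log s ≤ Fintype.card n + frobeniusSq H / c := by
  have hs0 : 0 < s := (Real.exp_pos 1).trans_le hs
  rw [logDetGram_eq_sum (by positivity), ← sum_eigenvalues_gram, Finset.sum_div, Finset.sum_div,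
    Fintype.card, Finset.card_eq_sum_ones, Nat.cast_sum, ← Finset.sum_add_distrib]
  refine Finset.sum_le_sum fun i _ => ?_
  have h := log_one_add_mul_div_log_le hs (div_nonneg (eigenvalues_gram_nonneg H i) hc.le)
  rw [mul_div_left_comm, mul_comm _ (s / c)] at h
  rwa [Nat.cast_one]

/-- Each nonzero eigenvalue of HᴴH contributes 1 in the limit and each zero eigenvalue contributes
0; their count is the rank of HᴴH, hence of H. -/
theorem tendsto_logDetGram_div_log {c : ℝ} (hc : 0 < c) (H : Matrix (Fin nR) n ℂ) :
    Tendsto (fun s : ℝ => logDetGram (s / c) H / Real.log s) atTop (𝓝 (H.rank : ℝ)) := by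
  have hr : (H.rank : ℝ) = ∑ i, if (isHermitian_gram H).eigenvalues i ≠ 0 then 1 else 0 := by
    rw [← rank_conjTranspose_mul_self, (isHermitian_gram H).rank_eq_card_non_zero_eigs,
      Fintype.card_subtype, Finset.card_filter, Nat.cast_sum]
    simp
  have h (i : n) : Tendsto (fun s : ℝ =>
      Real.log (1 + s * ((isHermitian_gram H).eigenvalues i / c)) / Real.log s) atTop
      (𝓝 (if (isHermitian_gram H).eigenvalues i ≠ 0 then 1 else 0)) := by
    split_ifs with hi
    · exact tendsto_log_one_add_mul_div_log
        (div_pos (lt_of_le_of_ne (eigenvalues_gram_nonneg H i) (Ne.symm hi)) hc)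
    · simp [not_not.mp hi]
  rw [hr]
  refine (tendsto_finsetSum _ fun i _ => h i).congr' ?_
  filter_upwards [eventually_gt_atTop 0] with s hs
  rw [logDetGram_eq_sum (by positivity), Finset.sum_div]
  refine Finset.sum_congr rfl fun i _ => ?_
  rw [mul_div_left_comm, mul_comm _ (s / c)]

end LogDetAsymptotics

/-! ### Almost sure full rank of column submatrices. -/

section GenericRank

theorem complexGaussian_ae_ne (a : ℂ) : ∀ᵐ z ∂complexGaussian 1, z ≠ a := by
  have := nullSingletonClass_gaussianReal (μ := 0) (v := 1 / 2) (by norm_num)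
  have h := (measurePreserving_equivRealProd_symm 1).measure_preimage
    (measurableSet_singleton a).nullMeasurableSet
  have hpre : Complex.measurableEquivRealProd.symm ⁻¹' {a} ⊆ {a.re} ×ˢ {a.im} := by
    rintro ⟨x, y⟩ rfl
    exact ⟨rfl, rfl⟩
  rw [ae_iff]
  simp only [not_not, Set.ofPred_eq_eq_singleton]
  rw [← h]
  refine measure_mono_null hpre ?_
  rw [Measure.prod_prod, measure_singleton, zero_mul]

variable {ι : Type*} [Fintype ι] [DecidableEq ι] {E : Type*} {mE : MeasurableSpace E}
  {μ : ι → Measure E} [∀ i, IsProbabilityMeasure (μ i)]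

theorem measurable_update_uncurry (i : ι) :
    Measurable fun p : (ι → E) × E => Function.update p.1 i p.2 := by
  refine measurable_pi_lambda _ fun j => ?_
  by_cases hj : j = i
  · subst hj
    simpa using measurable_snd
  · simpa [Function.update_of_ne hj] using (by fun_prop : Measurable fun p : (ι → E) × E => p.1 j)

/-- Resampling one coordinate of a product measure. -/
theorem measurePreserving_update (i : ι) :
    MeasurePreserving (fun p : (ι → E) × E => Function.update p.1 i p.2)
      ((Measure.pi μ).prod (μ i)) (Measure.pi μ) := by
  refine ⟨measurable_update_uncurry i, (Measure.pi_eq fun s hs => ?_).symm⟩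
  rw [Measure.map_apply (measurable_update_uncurry i) (MeasurableSet.univ_pi hs)]
  have hpre : (fun p : (ι → E) × E => Function.update p.1 i p.2) ⁻¹' Set.univ.pi s =
      (Set.univ.pi (Function.update s i Set.univ)) ×ˢ s i := by
    ext ⟨x, t⟩
    simp only [Set.mem_preimage, Set.mem_pi, Set.mem_univ, true_imp_iff, Set.mem_prod]
    constructor
    · intro h
      refine ⟨fun j => ?_, by simpa using h i⟩
      by_cases hj : j = i
      · subst hj; simp
      · simpa [Function.update_of_ne hj] using h j
    · rintro ⟨h1, h2⟩ j
      by_cases hj : j = i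
      · subst hj; simpa using h2
      · simpa [Function.update_of_ne hj] using h1 j
  rw [hpre, Measure.prod_prod, Measure.pi_pi, ← Finset.mul_prod_erase _ _ (Finset.mem_univ i),
    ← Finset.mul_prod_erase _ (fun i => μ i (s i)) (Finset.mem_univ i), Function.update_self,
    measure_univ, one_mul, mul_comm]
  congr 1
  refine Finset.prod_congr rfl fun j hj => ?_
  rw [Function.update_of_ne (Finset.ne_of_mem_erase hj)]

theorem ae_pi_of_ae_ae_update (i : ι) {p : (ι → E) → Prop} (hp : MeasurableSet {x | p x})
    (h : ∀ᵐ x ∂Measure.pi μ, ∀ᵐ t ∂μ i, p (Function.update x i t)) : ∀ᵐ x ∂Measure.pi μ, p x := by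
  rw [← (measurePreserving_update (μ := μ) i).map_eq,
    ae_map_iff (measurable_update_uncurry i).aemeasurable hp, Measure.ae_prod_iff_ae_ae]
  · exact h
  · exact measurable_update_uncurry i hp

variable {nR nT : ℕ}

theorem measurable_det_submatrix {k : ℕ} (r : Fin k → Fin nR) (c : Fin k → Fin nT) :
    Measurable fun H : Fin nR → Fin nT → ℂ => ((of H).submatrix r c).det := by
  refine Continuous.measurable (Continuous.matrix_det ?_)
  refine continuous_matrix fun i j => ?_
  simp only [submatrix_apply, of_apply]
  fun_prop

/-- Induction on size. Resample the entry at (r 0, c 0): by expansion along the first row the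
determinant is affine in it, with slope a smaller minor that is almost surely nonzero. Only one
value of the entry is then bad, and the law has no atoms. -/
theorem ae_det_submatrix_ne_zero {k : ℕ} {r : Fin k → Fin nR} {c : Fin k → Fin nT}
    (hr : Function.Injective r) (hc : Function.Injective c) :
    ∀ᵐ H ∂channelLaw nR nT, ((of H).submatrix r c).det ≠ 0 := by
  induction k with
  | zero => simp
  | succ k ih =>
    have hmeas : MeasurableSet {H : Fin nR → Fin nT → ℂ | ((of H).submatrix r c).det ≠ 0} :=
      (measurable_det_submatrix r c (measurableSet_singleton 0)).compl
    refine ae_pi_of_ae_ae_update (r 0) hmeas ?_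
    filter_upwards [ih (hr.comp (Fin.succ_injective k)) (hc.comp (Fin.succ_injective k))] with H hH
    have hmeas' : MeasurableSet {x : Fin nT → ℂ |
        ((of (Function.update H (r 0) x)).submatrix r c).det ≠ 0} :=
      (measurable_update H (a := r 0)) hmeas
    refine ae_pi_of_ae_ae_update (c 0) hmeas' (ae_of_all _ fun x => ?_)
    -- The cofactors omit row r 0, which by injectivity of r occurs only once, so they do not see
    -- the resampling.
    have hsub (t : ℂ) (j : Fin (k + 1)) :
        (((of (Function.update H (r 0) (Function.update x (c 0) t))).submatrix r c).submatrix
          Fin.succ j.succAbove) = (((of H).submatrix r c).submatrix Fin.succ j.succAbove) := by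
      ext a b
      simp [hr.ne (Fin.succ_ne_zero a)]
    have hdet (t : ℂ) :
        ((of (Function.update H (r 0) (Function.update x (c 0) t))).submatrix r c).det =
          t * ((of H).submatrix (r ∘ Fin.succ) (c ∘ Fin.succ)).det +
          ∑ j : Fin k, (-1) ^ ((j.succ : Fin (k + 1)) : ℕ) * x (c j.succ) *
            (((of H).submatrix r c).submatrix Fin.succ j.succ.succAbove).det := by
      rw [det_succ_row_zero, Fin.sum_univ_succ]
      simp_rw [hsub]
      congr 1
      · simp
      · refine Finset.sum_congr rfl fun j _ => ?_
        simp [hc.ne (Fin.succ_ne_zero j)]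
    set D := ((of H).submatrix (r ∘ Fin.succ) (c ∘ Fin.succ)).det
    set S := ∑ j : Fin k, (-1) ^ ((j.succ : Fin (k + 1)) : ℕ) * x (c j.succ) *
            (((of H).submatrix r c).submatrix Fin.succ j.succ.succAbove).det
    filter_upwards [complexGaussian_ae_ne (-S / D)] with t ht
    rw [hdet]
    intro h0
    exact ht (by rw [eq_div_iff hH]; linear_combination h0)

/-- One nonvanishing minor of the largest possible size bounds the rank from below; the matrix
dimensions bound it from above. -/
theorem ae_rank_submatrix_eq {n : Type*} [Fintype n] {f : n → Fin nT} (hf : Function.Injective f) :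
    ∀ᵐ H ∂channelLaw nR nT, ((of H).submatrix id f).rank = min nR (Fintype.card n) := by
  obtain ⟨k, hk⟩ : ∃ k, k = min nR (Fintype.card n) := ⟨_, rfl⟩
  have hkr : k ≤ nR := hk ▸ min_le_left _ _
  have hkc : k ≤ Fintype.card n := hk ▸ min_le_right _ _
  let c : Fin k → n := (Fintype.equivFin n).symm ∘ Fin.castLE hkc
  have hc : Function.Injective c :=
    (Fintype.equivFin n).symm.injective.comp (Fin.castLE_injective hkc)
  filter_upwards [ae_det_submatrix_ne_zero (Fin.castLE_injective hkr) (hf.comp hc)] with H hH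
  refine le_antisymm (le_min ((rank_le_card_height _).trans_eq (Fintype.card_fin nR)) (rank_le_card_width _)) ?_
  have h1 : ((of H).submatrix (Fin.castLE hkr) (f ∘ c)).rank = k :=
    (rank_of_isUnit _ ((isUnit_iff_isUnit_det _).mpr (isUnit_iff_ne_zero.mpr hH))).trans
      (Fintype.card_fin k)
  have h2 := rank_submatrix_le ((of H).submatrix id f) (Fin.castLE hkr) c
  rw [submatrix_submatrix, Function.id_comp, h1] at h2
  rwa [← hk]

end GenericRank

/-! ### Integrability and limit of expected log-determinants. -/

section ErgodicLimit

variable {nR nT : ℕ} {n : Type*} [Fintype n] [DecidableEq n] {f : n → Fin nT}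

theorem integrable_frobeniusSq_submatrix :
    Integrable (fun H : Fin nR → Fin nT → ℂ => frobeniusSq ((of H).submatrix id f))
      (channelLaw nR nT) := by
  unfold frobeniusSq
  refine integrable_finsetSum _ fun j _ => integrable_finsetSum _ fun i _ => ?_
  have h1 : Integrable (fun x : Fin nT → ℂ => ‖x (f j)‖ ^ 2)
      (Measure.pi fun _ : Fin nT => complexGaussian 1) :=
    integrable_comp_eval (μ := fun _ : Fin nT => complexGaussian 1)
      (integrable_norm_sq_complexGaussian 1)
  exact integrable_comp_eval
    (μ := fun _ : Fin nR => Measure.pi fun _ : Fin nT => complexGaussian 1) (i := i) h1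

theorem measurable_logDetGram_submatrix (ρ : ℝ) :
    Measurable fun H : Fin nR → Fin nT → ℂ => logDetGram ρ ((of H).submatrix id f) := by
  unfold logDetGram
  refine Real.measurable_log.comp (Complex.measurable_re.comp
    (Continuous.measurable (Continuous.matrix_det ?_)))
  refine continuous_matrix fun i j => ?_
  simp only [Matrix.add_apply, Matrix.smul_apply, mul_apply, conjTranspose_apply, submatrix_apply,
    of_apply]
  fun_prop

theorem integrable_logDetGram_submatrix {ρ : ℝ} (hρ : 0 ≤ ρ) :
    Integrable (fun H : Fin nR → Fin nT → ℂ => logDetGram ρ ((of H).submatrix id f))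
      (channelLaw nR nT) := by
  refine Integrable.mono' ((integrable_frobeniusSq_submatrix (f := f)).const_mul ρ)
    (measurable_logDetGram_submatrix ρ).aestronglyMeasurable (ae_of_all _ fun H => ?_)
  rw [Real.norm_of_nonneg (logDetGram_nonneg hρ _)]
  exact logDetGram_le hρ _

theorem tendsto_integral_logDetGram_div_log (hf : Function.Injective f) {c : ℝ} (hc : 0 < c) :
    Tendsto (fun s : ℝ =>
        (∫ H : Fin nR → Fin nT → ℂ, logDetGram (s / c) ((of H).submatrix id f) ∂channelLaw nR nT) /
          Real.log s) atTop (𝓝 ((min nR (Fintype.card n) : ℕ) : ℝ)) := by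
  simp_rw [← integral_div]
  have hlim : ∫ _ : Fin nR → Fin nT → ℂ, ((min nR (Fintype.card n) : ℕ) : ℝ) ∂channelLaw nR nT =
      ((min nR (Fintype.card n) : ℕ) : ℝ) := by simp
  rw [← hlim]
  refine tendsto_integral_filter_of_dominated_convergence
    (fun H => Fintype.card n + frobeniusSq ((of H).submatrix id f) / c)
    (Eventually.of_forall fun s =>
      ((measurable_logDetGram_submatrix _).div_const _).aestronglyMeasurable) ?_
    ((integrable_const _).add (integrable_frobeniusSq_submatrix.div_const c)) ?_
  · filter_upwards [eventually_ge_atTop (Real.exp 1)] with s hs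
    refine ae_of_all _ fun H => ?_
    have hs0 : 0 < s := (Real.exp_pos 1).trans_le hs
    have hs1 : 1 ≤ s := (Real.one_le_exp zero_le_one).trans hs
    rw [Real.norm_of_nonneg
      (div_nonneg (logDetGram_nonneg (by positivity) _) (Real.log_nonneg hs1))]
    exact logDetGram_div_log_le hs hc _
  · filter_upwards [ae_rank_submatrix_eq (nR := nR) hf] with H hH
    rw [← hH]
    exact tendsto_logDetGram_div_log hc _

end ErgodicLimit

/-! ### Consecutive blocks as fibres of a labelling map. -/

section BlockLabels

variable {M : ℕ} {K : Fin M → ℕ}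

theorem blockStart_eq_sum_fin (m : Fin M) :
    blockStart K m = ∑ i : Fin m, K (Fin.castLE m.2.le i) := by
  refine (Finset.sum_bij (fun i _ => Fin.castLE m.2.le i) (fun i _ => ?_) (fun i _ j _ h => ?_)
    (fun l hl => ?_) fun _ _ => rfl).symm
  · exact Finset.mem_Iio.mpr (Fin.lt_def.mpr i.2)
  · exact Fin.castLE_injective _ h
  · exact ⟨⟨l, Fin.lt_def.mp (Finset.mem_Iio.mp hl)⟩, Finset.mem_univ _, rfl⟩

theorem blockStart_add_le {m m' : Fin M} (h : m < m') :
    blockStart K m + K m ≤ blockStart K m' := by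
  rw [blockStart, blockStart, add_comm, ← Finset.sum_insert (by simp)]
  refine Finset.sum_le_sum_of_subset fun l hl => ?_
  rcases Finset.mem_insert.mp hl with rfl | hl
  · exact Finset.mem_Iio.mpr h
  · exact Finset.mem_Iio.mpr ((Finset.mem_Iio.mp hl).trans h)

theorem block_unique {m m' : Fin M} {i : ℕ} (h : blockStart K m ≤ i ∧ i < blockStart K m + K m)
    (h' : blockStart K m' ≤ i ∧ i < blockStart K m' + K m') : m = m' := by
  rcases lt_trichotomy m m' with hlt | heq | hlt
  · have := blockStart_add_le (K := K) hlt
    omega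
  · exact heq
  · have := blockStart_add_le (K := K) hlt
    omega

/-- `finSigmaFinEquiv` lays the blocks out consecutively; b is the first component of its inverse,
and its fibres are the blocks. -/
theorem exists_blockLabel {nT : ℕ} (hK : ∑ m, K m = nT) : ∃ b : Fin nT → Fin M,
    (∀ i, blockStart K (b i) ≤ i ∧ (i : ℕ) < blockStart K (b i) + K (b i)) ∧
    ∀ m, Fintype.card {i // b i = m} = K m := by
  subst hK
  refine ⟨fun i => (finSigmaFinEquiv.symm i).1, fun i => ?_, fun m => ?_⟩
  · have h := finSigmaFinEquiv_apply (finSigmaFinEquiv.symm i)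
    rw [Equiv.apply_symm_apply, ← blockStart_eq_sum_fin] at h
    have h2 := (finSigmaFinEquiv.symm i).2.2
    dsimp only
    omega
  · have e : {i // (finSigmaFinEquiv.symm i).1 = m} ≃ {p : (m : Fin M) × Fin (K m) // p.1 = m} :=
      finSigmaFinEquiv.symm.subtypeEquiv fun i => Iff.rfl
    rw [Fintype.card_congr (e.trans (Equiv.sigmaSubtype m)), Fintype.card_fin]

theorem isBlockDiag_iff {nT : ℕ} {b : Fin nT → Fin M}
    (hb : ∀ i, blockStart K (b i) ≤ i ∧ (i : ℕ) < blockStart K (b i) + K (b i))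
    (G : Matrix (Fin nT) (Fin nT) ℂ) :
    IsBlockDiag K G ↔ ∀ i j, b i ≠ b j → G i j = 0 := by
  constructor
  · intro h i j hij
    by_contra hG
    obtain ⟨m, hi, hj⟩ := h i j hG
    exact hij ((block_unique (hb i) hi).trans (block_unique (hb j) hj).symm)
  · intro h i j hG
    have hij : b i = b j := by
      by_contra hij
      exact hG (h i j hij)
    exact ⟨b i, hb i, hij ▸ hb j⟩

theorem card_blockLabel_compl {nT : ℕ} {b : Fin nT → Fin M}
    (hcard : ∀ m, Fintype.card {i // b i = m} = K m) (m : Fin M) :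
    Fintype.card {i // ¬b i = m} = nT - K m := by
  rw [Fintype.card_subtype_compl, hcard, Fintype.card_fin]

end BlockLabels

/-! ### The degenerate case without transmit antennas. -/

section NoTransmitAntenna

variable {nR M : ℕ} {K : Fin M → ℕ}

/-- Needed separately because `noiseDensity` is 0 when nT = 0, while the closed form assumes
positive noise. -/
theorem blockGmiValues_zero (H : Matrix (Fin nR) (Fin 0) ℂ) (N0 : ℝ≥0) :
    blockGmiValues K H N0 = {0} := by
  have hfun (Hr : Matrix (Fin 0) (Fin nR) ℂ) (Gr : Matrix (Fin 0) (Fin 0) ℂ) (y : Fin nR → ℂ) :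
      receiverFun Hr Gr y = fun _ => 1 := by
    funext x
    simp [receiverFun]
  have hgmi (Hr : Matrix (Fin 0) (Fin nR) ℂ) (Gr : Matrix (Fin 0) (Fin 0) ℂ) :
      gmi H N0 Hr Gr = 0 := by
    simp [gmi, receiverMarginal, hfun]
  ext r
  constructor
  · rintro ⟨Hr, Gr, -, -, -, rfl⟩
    exact hgmi Hr Gr
  · rintro rfl
    refine ⟨0, 0, isHermitian_zero, fun i => i.elim0, fun y => ?_, (hgmi 0 0).symm⟩
    rw [hfun]
    exact integrable_const 1

theorem blockGmi_zero (H : Matrix (Fin nR) (Fin 0) ℂ) (N0 : ℝ≥0) : blockGmi K H N0 = 0 := by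
  rw [blockGmi, blockGmiValues_zero, csSup_singleton]

end NoTransmitAntenna

/-! ### The high-SNR slope. -/

section HighSnr

variable {nR nT M : ℕ} {K : Fin M → ℕ} {b : Fin nT → Fin M}

theorem coe_noiseDensity_inv {snr : ℝ} (hs : 0 < snr) :
    ((noiseDensity nT snr : ℝ≥0) : ℝ)⁻¹ = snr / nT := by
  rw [noiseDensity, Real.coe_toNNReal _ (by positivity), inv_div]

theorem noiseDensity_pos (hnT : 0 < nT) {snr : ℝ} (hs : 0 < snr) : 0 < noiseDensity nT snr :=
  Real.toNNReal_pos.mpr (by positivity)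

theorem blockGmi_noiseDensity
    (hb : ∀ G : Matrix (Fin nT) (Fin nT) ℂ, IsBlockDiag K G ↔ ∀ i j, b i ≠ b j → G i j = 0)
    (hnT : 0 < nT) {snr : ℝ} (hs : 0 < snr) (H : Matrix (Fin nR) (Fin nT) ℂ) :
    blockGmi K H (noiseDensity nT snr) =
      -- H is written as `H.submatrix id id` so that the submatrix lemmas apply to both terms.
      ∑ m, (logDetGram (snr / nT) (H.submatrix id id) -
        logDetGram (snr / nT) (H.submatrix id (Subtype.val : {i // ¬b i = m} → Fin nT))) := by
  rw [blockGmi, (isGreatest_blockGmiValues hb H (noiseDensity_pos hnT hs)).csSup_eq]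
  simp_rw [coe_noiseDensity_inv hs, submatrix_id_id]

theorem isGreatest_blockGmi
    (hb : ∀ G : Matrix (Fin nT) (Fin nT) ℂ, IsBlockDiag K G ↔ ∀ i j, b i ≠ b j → G i j = 0)
    (H : Matrix (Fin nR) (Fin nT) ℂ) {N0 : ℝ≥0} (hN : 0 < N0) :
    IsGreatest (blockGmiValues K H N0) (blockGmi K H N0) := by
  have h := isGreatest_blockGmiValues hb H hN
  rwa [blockGmi, h.csSup_eq]

theorem integrable_blockGmi
    (hb : ∀ G : Matrix (Fin nT) (Fin nT) ℂ, IsBlockDiag K G ↔ ∀ i j, b i ≠ b j → G i j = 0)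
    (hnT : 0 < nT) {snr : ℝ} (hs : 0 < snr) :
    Integrable (fun H : Fin nR → Fin nT → ℂ => blockGmi K (of H) (noiseDensity nT snr))
      (channelLaw nR nT) := by
  simp_rw [blockGmi_noiseDensity hb hnT hs]
  exact integrable_finsetSum _ fun m _ => (integrable_logDetGram_submatrix (by positivity)).sub
    (integrable_logDetGram_submatrix (by positivity))

theorem tendsto_ergodicBlockRate_div_log
    (hb : ∀ G : Matrix (Fin nT) (Fin nT) ℂ, IsBlockDiag K G ↔ ∀ i j, b i ≠ b j → G i j = 0)
    (hcard : ∀ m, Fintype.card {i // b i = m} = K m) (hnT : 0 < nT) :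
    Tendsto (fun snr : ℝ => ergodicBlockRate nR nT K snr / Real.log snr) atTop
      (𝓝 (∑ m, (((min nR nT : ℕ) : ℝ) - ((min nR (nT - K m) : ℕ) : ℝ)))) := by
  have hc : (0 : ℝ) < nT := by exact_mod_cast hnT
  have h (m : Fin M) := (tendsto_integral_logDetGram_div_log (nR := nR) (nT := nT)
    Function.injective_id hc).sub (tendsto_integral_logDetGram_div_log (nR := nR) (nT := nT)
      (Subtype.val_injective (p := fun i => ¬b i = m)) hc)
  simp_rw [card_blockLabel_compl hcard, Fintype.card_fin] at h
  refine (tendsto_finsetSum _ fun m _ => h m).congr' ?_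
  filter_upwards [eventually_gt_atTop 0] with s hs
  rw [ergodicBlockRate]
  simp_rw [blockGmi_noiseDensity hb hnT hs]
  have hρ : 0 ≤ s / nT := by positivity
  have hint (m : Fin M) : Integrable (fun H : Fin nR → Fin nT → ℂ =>
      logDetGram (s / nT) ((of H).submatrix id id) -
        logDetGram (s / nT) ((of H).submatrix id (Subtype.val : {i // ¬b i = m} → Fin nT)))
      (channelLaw nR nT) :=
    (integrable_logDetGram_submatrix hρ).sub (integrable_logDetGram_submatrix hρ)
  rw [integral_finsetSum _ fun m _ => hint m, Finset.sum_div]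
  refine Finset.sum_congr rfl fun m _ => ?_
  rw [integral_sub (integrable_logDetGram_submatrix hρ) (integrable_logDetGram_submatrix hρ),
    sub_div]

theorem sum_min_sub_min_of_le (hK : ∑ m, K m = nT) (h : nT ≤ nR) :
    ∑ m, (((min nR nT : ℕ) : ℝ) - ((min nR (nT - K m) : ℕ) : ℝ)) = nT := by
  rw [← hK, Nat.cast_sum]
  refine Finset.sum_congr rfl fun m _ => ?_
  have hm : K m ≤ nT := hK ▸ Finset.single_le_sum (fun _ _ => Nat.zero_le _) (Finset.mem_univ m)
  rw [hK, min_eq_right h, min_eq_right ((Nat.sub_le _ _).trans h), Nat.cast_sub hm]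
  ring

/-- Deleting block m lowers the generic rank nR only if fewer than nR columns remain, that is if Kₘ
> nT - nR; the loss is then nR - (nT - Kₘ). -/
theorem sum_min_sub_min_of_lt (hK : ∑ m, K m = nT) (h : nR < nT) :
    ∑ m, (((min nR nT : ℕ) : ℝ) - ((min nR (nT - K m) : ℕ) : ℝ)) =
      ∑ m with (nT : ℤ) - (nR : ℤ) < (K m : ℤ), ((K m : ℝ) - ((nT : ℝ) - (nR : ℝ))) := by
  rw [Finset.sum_filter]
  refine Finset.sum_congr rfl fun m _ => ?_
  have hm : K m ≤ nT := hK ▸ Finset.single_le_sum (fun _ _ => Nat.zero_le _) (Finset.mem_univ m)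
  rw [min_eq_left h.le]
  split_ifs with hlt
  · rw [min_eq_right (by omega), Nat.cast_sub hm]
    ring
  · rw [min_eq_left (by omega), sub_self]

end HighSnr

end ChannelShortening

end

theorem mainTheorem8 (nR nT M : ℕ) (K : Fin M → ℕ) (hK : ∑ m, K m = nT) :
    (∀ snr : ℝ, 0 < snr →
      (∀ H : Matrix (Fin nR) (Fin nT) ℂ,
        IsGreatest
          (ChannelShortening.blockGmiValues K H (ChannelShortening.noiseDensity nT snr))
          (ChannelShortening.blockGmi K H (ChannelShortening.noiseDensity nT snr))) ∧
      Integrable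
        (fun H : Fin nR → Fin nT → ℂ =>
          ChannelShortening.blockGmi K (Matrix.of H) (ChannelShortening.noiseDensity nT snr))
        (ChannelShortening.channelLaw nR nT)) ∧
    (nT ≤ nR →
      Tendsto (fun snr : ℝ => ChannelShortening.ergodicBlockRate nR nT K snr / Real.log snr)
        atTop (𝓝 (nT : ℝ))) ∧
    (nR < nT →
      Tendsto (fun snr : ℝ => ChannelShortening.ergodicBlockRate nR nT K snr / Real.log snr)
        atTop (𝓝 (∑ m with (nT : ℤ) - (nR : ℤ) < (K m : ℤ),
          ((K m : ℝ) - ((nT : ℝ) - (nR : ℝ)))))) := by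
  rcases Nat.eq_zero_or_pos nT with h0 | hnT
  · subst h0
    have hrate (snr : ℝ) : ChannelShortening.ergodicBlockRate nR 0 K snr = 0 := by
      simp [ChannelShortening.ergodicBlockRate, ChannelShortening.blockGmi_zero]
    refine ⟨fun snr _ => ⟨fun H => ?_, ?_⟩, fun _ => ?_, fun h => absurd h (Nat.not_lt_zero _)⟩
    · rw [ChannelShortening.blockGmi_zero, ChannelShortening.blockGmiValues_zero]
      exact isGreatest_singleton
    · simp_rw [ChannelShortening.blockGmi_zero]
      exact integrable_const 0
    · simp [hrate]
  · obtain ⟨b, hb, hcard⟩ := ChannelShortening.exists_blockLabel hK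
    have hbd := ChannelShortening.isBlockDiag_iff hb
    have hlim := ChannelShortening.tendsto_ergodicBlockRate_div_log (nR := nR) hbd hcard hnT
    refine ⟨fun snr hs => ⟨fun H => ChannelShortening.isGreatest_blockGmi hbd H
      (ChannelShortening.noiseDensity_pos hnT hs),
      ChannelShortening.integrable_blockGmi hbd hnT hs⟩, fun h => ?_, fun h => ?_⟩
    · rwa [ChannelShortening.sum_min_sub_min_of_le hK h] at hlim
    · rwa [ChannelShortening.sum_min_sub_min_of_lt hK h] at hlim
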